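/- **Notation.** Let $\{a_1\prec a_2\prec\dots\prec a_l\}$ be an ordered alphabet of $l$ letters. For words $u,v$ write $u\succ v$ if, at the first position where they differ, $u$ has the greater letter (a word and a prefix of it are incomparable). A word $W$ is *$n$-divisible* if $W=v\,u_1u_2\cdots u_n$ for some words with $u_1\succ u_2\succ\dots\succ u_n$. The *height* of a set $\mathcal M$ of words over a set $Y$ of words is the least $h$ such that every $u\in\mathcal M$ has the form $u=y_1^{k_1}\cdots y_r^{k_r}$ with $r\le h$, $y_i\in Y$. The *height* of an algebra $A$ with given generators over a set $Y$ of words in these generators is the least $h$ such that every element of $A$ is a linear combination of elements $y_1^{k_1}\cdots y_r^{k_r}$ with $r\le h$, $y_i\in Y$. A polynomial identity $f=0$ over a commutative ring $K$ ($f$ a noncommutative polynomial over $K$) is *admissible* if one of the coefficients of $f$ equals $1$. For $n\ge 2$ put $$\Phi(n,l)=2^{96}\,l\cdot n^{12\log_3 n+36\log_3\log_3 n+91}.$$ **Theorem.** 1. For all $n\ge2$ and $l\ge 0$, the set of words over an $l$-letter alphabet that are not $n$-divisible has finite height over the set of words of length less than $n$, and this height is at most $\Phi(n,l)$. 2. The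 bound is subexponential in $n$ and linear in $l$: for fixed $l\ge1$ and $n\to\infty$, $\Phi(n,l)=n^{12(1+o(1))\log_3 n}$, and hence $\Phi(n,l)=o(c^n)$ for every $c>1$ and every fixed $l\ge 0$; for each fixed $n\ge2$ there is a constant $C(n)$ with $\Phi(n,l)<C(n)\,l$ for all $l\ge1$. 3. Let $A$ be an associative algebra over a commutative ring, generated by $l$ elements, that satisfies an admissible polynomial identity of degree $n\ge2$. Then $A$ has finite height over the set of words of length less than $n$ in the generators, and this height is at most $\Phi(n,l)$. This holds both for algebras not assumed to have a unit, and for unital algebras that are generated by $l$ elements as unital algebras (where the empty word is allowed and $f$ may have a constant term). 4. (Answer to Zelmanov's question, which is the case $l=2$.) Let $F_{l,m}$ be the free $l$-generated associative ring without unit with the identity $x^m=0$, $m\ge1$. Then $F_{l,m}$ is nilpotent, and for each fixed $l$ its nilpotency class, i.e. the least $N$ with $F_{l,m}^N=0$, grows subexponentially in $m$: it is $o(c^m)$ as $m\to\infty$ for every $c>1$. -/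

import Mathlib

noncomputable section

namespace Shirshov

/-- The lexicographic order on words: `LexGT u v` says `u ≻ v`, i.e. at the first place where
they differ `u` has the greater letter. Words one of which is a prefix of the other are
incomparable. -/
def LexGT {α : Type*} [LinearOrder α] (u v : FreeMonoid α) : Prop :=
  ∃ (p s t : FreeMonoid α) (a b : α), b < a ∧
    u = p * FreeMonoid.of a * s ∧ v = p * FreeMonoid.of b * t

/-- `W` is `n`-divisible: `W = v u₁ ⋯ uₙ` with `u₁ ≻ ⋯ ≻ uₙ`. -/
def NDivisible {α : Type*} [LinearOrder α] (n : ℕ) (W : FreeMonoid α) : Prop :=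
  ∃ (v : FreeMonoid α) (us : List (FreeMonoid α)),
    us.length = n ∧ us.Pairwise LexGT ∧ W = v * us.prod

/-- The elements `u₁ ^ k₁ ⋯ u_r ^ k_r` with `r ≤ h` and all `u_i` in `Y`. -/
def powProducts {M : Type*} [Monoid M] (Y : Set M) (h : ℕ) : Set M :=
  {x | ∃ L : List (M × ℕ), L.length ≤ h ∧ (∀ p ∈ L, p.1 ∈ Y) ∧
    x = (L.map fun p => p.1 ^ p.2).prod}

/-- The words of length less than `n`. -/
def shortWords (α : Type*) (n : ℕ) : Set (FreeMonoid α) :=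
  {w | w.length < n}

/-- `h` is the height of the set of words `S` over the set of words `Y`. -/
def IsSetHeight {α : Type*} (S Y : Set (FreeMonoid α)) (h : ℕ) : Prop :=
  IsLeast {k : ℕ | S ⊆ powProducts Y k} h

/-- `h` is the least number such that every element of the submodule `S` of the algebra `B` is a
linear combination of products of at most `h` powers of elements of `Y`. -/
def IsSpanHeight (K : Type*) {B : Type*} [CommRing K] [Ring B] [Algebra K B]
    (S : Submodule K B) (Y : Set B) (h : ℕ) : Prop :=
  IsLeast {k : ℕ | S ≤ Submodule.span K (powProducts Y k)} h

/-- `h` is the height of the unital algebra `A`, with generators `a`, over the words of length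
less than `n` in these generators. -/
def IsUnitalAlgHeight (K : Type*) {A : Type*} [CommRing K] [Ring A] [Algebra K A]
    {l : ℕ} (a : Fin l → A) (n h : ℕ) : Prop :=
  IsSpanHeight K (⊤ : Submodule K A) (FreeMonoid.lift a '' shortWords (Fin l) n) h

/-- `h` is the height of the algebra `A` (not assumed unital), with generators `a`, over the words
of length less than `n` in these generators. Words are evaluated in the algebra obtained by
adjoining a unit; as all nonempty words lie in `A`, the empty word contributes nothing to the
linear combinations that represent elements of `A`. -/
def IsAlgHeight (K : Type*) {A : Type*} [CommRing K] [NonUnitalRing A] [Module K A]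
    [IsScalarTower K A A] [SMulCommClass K A A] {l : ℕ} (a : Fin l → A) (n h : ℕ) : Prop :=
  IsSpanHeight K (LinearMap.range (Unitization.inrHom K K A))
    (FreeMonoid.lift (fun i => (a i : Unitization K A)) '' shortWords (Fin l) n) h

/-- Noncommutative polynomials over `K` in the variables `x₀, x₁, …`: the free associative
algebra. -/
abbrev NCPoly (K : Type*) [CommRing K] : Type _ := MonoidAlgebra K (FreeMonoid ℕ)

/-- The degree of a noncommutative polynomial. -/
def NCPoly.degree {K : Type*} [CommRing K] (f : NCPoly K) : ℕ :=
  f.coeff.support.sup FreeMonoid.length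

/-- The value `f(x₀, x₁, …)` in a unital algebra. -/
def NCPoly.eval {K B : Type*} [CommRing K] [Ring B] [Algebra K B] (x : ℕ → B) (f : NCPoly K) : B :=
  MonoidAlgebra.lift K B (FreeMonoid ℕ) (FreeMonoid.lift x) f

/-- A polynomial is admissible if one of its coefficients is `1`. -/
def NCPoly.Admissible {K : Type*} [CommRing K] (f : NCPoly K) : Prop :=
  ∃ w, f.coeff w = 1

/-- `f = 0` is an identity of the unital algebra `A`. -/
def IsUnitalIdentity {K : Type*} (A : Type*) [CommRing K] [Ring A] [Algebra K A]
    (f : NCPoly K) : Prop :=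
  ∀ x : ℕ → A, f.eval x = 0

/-- `f = 0` is an identity of the algebra `A` (not assumed unital). The value is computed in the
algebra obtained by adjoining a unit; that it vanishes includes that `f` has no constant term. -/
def IsIdentity {K : Type*} (A : Type*) [CommRing K] [NonUnitalRing A] [Module K A]
    [IsScalarTower K A A] [SMulCommClass K A A] (f : NCPoly K) : Prop :=
  ∀ x : ℕ → A, f.eval (fun i => (x i : Unitization K A)) = 0

/-- `Φ(n, l) = 2⁹⁶ l n ^ (12 log₃ n + 36 log₃ log₃ n + 91)`. -/
def Phi (n l : ℕ) : ℝ :=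
  2 ^ 96 * (l : ℝ) * (n : ℝ) ^
    (12 * Real.logb 3 n + 36 * Real.logb 3 (Real.logb 3 n) + 91)

/-- The free associative ring without unit on `l` generators. -/
abbrev FreeNURing (l : ℕ) : Type := MonoidAlgebra ℤ (FreeSemigroup (Fin l))

/-- The ideal congruence on the free ring generated by `x ^ m = 0` for all `x`. -/
def nilCon (l m : ℕ) : RingCon (FreeNURing l) :=
  ringConGen fun y z => z = 0 ∧ ∃ x : FreeNURing l,
    (y : Unitization ℤ (FreeNURing l)) = (x : Unitization ℤ (FreeNURing l)) ^ m

/-- The free `l`-generated associative ring with the identity `x ^ m = 0`. -/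
abbrev FreeNilRing (l m : ℕ) : Type := (nilCon l m).Quotient

/-- `N` is the nilpotency class of `R`: the least `N` with `R ^ N = 0`, i.e. such that all products
of `N` elements vanish. (For `N = 0` the product is the unit adjoined to `R`, which is not zero.) -/
def IsNilpotencyClass (R : Type*) [NonUnitalRing R] (N : ℕ) : Prop :=
  IsLeast {k : ℕ | ∀ x : Fin k → R,
    (List.ofFn fun i => (x i : Unitization ℤ R)).prod = 0} N

end Shirshov

end

/-!
Let `W` be a word that is not `n`-divisible, and let `K = 2 ^ s` be a power of two in `(3n, 6n]`.
Color a position `x` by `x mod K` and by its rank, the greatest length of a chain of positions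
congruent to `x` modulo `K` that ends at `x` and along which the factors of length `K` strictly
decrease. As `W` is not `n`-divisible, the ranks stay below `n`, so there are few colors. Along the
positions of one color the factors of length `K` weakly increase, and therefore so do all shorter
ones. The factor of length `2 ^ i` at a position of a given color is thus determined by the number
of distinct (color, factor) pairs seen so far, which makes the two halves of a factor of length
`2 ^ (i + 1)` cost only a polynomial factor in `n`: the number of pairs is multiplied by such a
factor at each doubling, and after `log₂ K` doublings it is quasi-polynomial in `n`, and linear
in `l`.

If the first `n` tails of the factor at a position are pairwise comparable, then this factor occurs
fewer than `n` times among the positions of its color; otherwise an overlap of the tails produces a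
factor of length `2n - 1` with a period less than `n`. So all but quasi-polynomially many positions
start such a periodic factor, and a run of consecutive periodic positions is of the form `u ^ j * t`
with `u` and `t` short. This bounds the height.

For algebras, replacing the variables of the identity by sums and taking alternating sums over the
sets of summands expresses an `n`-divisible word through lexicographically smaller words, up to
terms with coefficients of higher degree. In a nil ring of index `m`, a long word that is not
`m`-divisible contains an `m`-th power.
-/

namespace Shirshov

open Finset

/-- The lexicographic order on words, in which a proper prefix of a word is smaller than the word:
a linear order that extends the relation `LexGT`. -/
local instance instLinearOrderFreeMonoid {α : Type*} [LinearOrder α] :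
    LinearOrder (FreeMonoid α) :=
  inferInstanceAs (LinearOrder (List α))

section LexGT

variable {α : Type*} [LinearOrder α] {u v w : FreeMonoid α}

theorem LexGT.mul_left (w : FreeMonoid α) (h : LexGT u v) : LexGT (w * u) (w * v) := by
  obtain ⟨p, s, t, a, b, hab, rfl, rfl⟩ := h
  exact ⟨w * p, s, t, a, b, hab, by simp only [mul_assoc], by simp only [mul_assoc]⟩

theorem LexGT.mul_right (h : LexGT u v) (s t : FreeMonoid α) : LexGT (u * s) (v * t) := by
  obtain ⟨p, s', t', a, b, hab, rfl, rfl⟩ := h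
  exact ⟨p, s' * s, t' * t, a, b, hab, by simp only [mul_assoc], by simp only [mul_assoc]⟩

theorem lexGT_of_mul_of_mul {a b : α} (hab : b < a) (s t : FreeMonoid α) :
    LexGT (FreeMonoid.of a * s) (FreeMonoid.of b * t) :=
  ⟨1, s, t, a, b, hab, by rw [one_mul], by rw [one_mul]⟩

theorem LexGT.lt (h : LexGT u v) : v < u := by
  obtain ⟨p, s, t, a, b, hab, rfl, rfl⟩ := h
  rw [mul_assoc, mul_assoc]
  exact List.Lex.append_left _ (List.Lex.rel hab) p.toList

theorem le_mul_right_self (u t : FreeMonoid α) : u ≤ u * t :=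
  not_lt.1 (List.IsPrefix.le (List.prefix_append u.toList t.toList))

theorem lexGT_trichotomy (u v : FreeMonoid α) :
    LexGT u v ∨ LexGT v u ∨ (∃ t, v = u * t) ∨ ∃ t, u = v * t := by
  induction u using FreeMonoid.inductionOn' generalizing v with
  | one => exact .inr (.inr (.inl ⟨v, (one_mul v).symm⟩))
  | of_mul a u ih =>
    cases v with
    | one => exact .inr (.inr (.inr ⟨_, (one_mul _).symm⟩))
    | of_mul b v =>
      rcases lt_trichotomy a b with hab | rfl | hab
      · exact .inr (.inl (lexGT_of_mul_of_mul hab v u))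
      · rcases ih v with h | h | ⟨t, rfl⟩ | ⟨t, rfl⟩
        · exact .inl (h.mul_left _)
        · exact .inr (.inl (h.mul_left _))
        · exact .inr (.inr (.inl ⟨t, (mul_assoc ..).symm⟩))
        · exact .inr (.inr (.inr ⟨t, (mul_assoc ..).symm⟩))
      · exact .inl (lexGT_of_mul_of_mul hab u v)

theorem lexGT_or_exists_eq_mul_of_lt (h : v < u) : LexGT u v ∨ ∃ t, u = v * t := by
  rcases lexGT_trichotomy u v with huv | hvu | ⟨t, rfl⟩ | hprefix
  · exact .inl huv
  · exact absurd hvu.lt h.asymm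
  · exact absurd h (le_mul_right_self u t).not_gt
  · exact .inr hprefix

theorem lexGT_of_lt (h : v < u) (hlen : u.length ≤ v.length) : LexGT u v := by
  rcases lexGT_or_exists_eq_mul_of_lt h with huv | ⟨t, rfl⟩
  · exact huv
  · have ht : t = 1 := FreeMonoid.length_eq_zero.1 (by rw [FreeMonoid.length_mul] at hlen; omega)
    rw [ht, mul_one] at h
    exact absurd h (lt_irrefl v)

theorem LexGT.trans (huv : LexGT u v) (hvw : LexGT v w) : LexGT u w := by
  rcases lexGT_or_exists_eq_mul_of_lt (hvw.lt.trans huv.lt) with huw | ⟨t, rfl⟩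
  · exact huw
  · have hvu : LexGT v (w * t) := by simpa only [mul_one] using hvw.mul_right 1 t
    exact absurd hvu.lt huv.lt.asymm

theorem NDivisible.mono {m n : ℕ} {W : FreeMonoid α} (hmn : m ≤ n) (h : NDivisible n W) :
    NDivisible m W := by
  obtain ⟨v, us, hlen, hus, rfl⟩ := h
  refine ⟨v * (us.take (n - m)).prod, us.drop (n - m), by rw [List.length_drop]; omega,
    hus.sublist (List.drop_sublist _ _), ?_⟩
  rw [mul_assoc, List.prod_take_mul_prod_drop]

end LexGT

section Factor

variable {α : Type*}

/-- The factor of length `k` of the word `W` that starts at position `x`, counted from `0`; it is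
cut off at the end of `W`. -/
def factor (W : FreeMonoid α) (x k : ℕ) : FreeMonoid α :=
  FreeMonoid.ofList ((W.toList.drop x).take k)

variable {W : FreeMonoid α} {x y j k : ℕ}

theorem length_factor_le (W : FreeMonoid α) (x k : ℕ) : (factor W x k).length ≤ k :=
  List.length_take_le _ _

theorem length_factor (h : x + k ≤ W.length) : (factor W x k).length = k := by
  have hlen : (W.toList.drop x).length = W.length - x := List.length_drop
  exact List.length_take_of_le (by omega)

theorem factor_add (W : FreeMonoid α) (x j k : ℕ) :
    factor W x (j + k) = factor W x j * factor W (x + j) k := by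
  rw [factor, List.take_add, List.drop_drop]
  rfl

theorem factor_factor (h : x + j ≤ k) : factor (factor W y k) x j = factor W (y + x) j := by
  simp only [factor, FreeMonoid.toList_ofList, List.drop_take, List.take_take, List.drop_drop]
  rw [min_eq_left (by omega)]

theorem factor_zero_length (W : FreeMonoid α) : factor W 0 W.length = W := by
  rw [factor, List.drop_zero]
  exact List.take_length

theorem exists_eq_factor_mul (W : FreeMonoid α) (k : ℕ) : ∃ s, W = factor W 0 k * s :=
  ⟨FreeMonoid.ofList (W.toList.drop k), (List.take_append_drop k W.toList).symm⟩

theorem factor_eq_factor_iff :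
    factor W x k = factor W y k ↔ ∀ i < k, W.toList[x + i]? = W.toList[y + i]? := by
  simp only [factor, EmbeddingLike.apply_eq_iff_eq, List.ext_getElem?_iff, List.getElem?_take,
    List.getElem?_drop]
  refine forall_congr' fun i => ?_
  by_cases hi : i < k <;> simp [hi]

theorem factor_le_factor [LinearOrder α] (hxy : x < y) (hy : y + k ≤ W.length) (hjk : j ≤ k)
    (h : factor W x k ≤ factor W y k) : factor W x j ≤ factor W y j := by
  by_contra! hlt
  obtain ⟨i, rfl⟩ := Nat.exists_eq_add_of_le hjk
  have hgt : LexGT (factor W x j) (factor W y j) := lexGT_of_lt hlt <| by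
    rw [length_factor (by omega), length_factor (by omega)]
  rw [factor_add, factor_add] at h
  exact h.not_gt (hgt.mul_right _ _).lt

end Factor

section Divisibility

variable {α : Type*} [LinearOrder α] {W : FreeMonoid α}

theorem exists_eq_mul_prod_of_isChain (p : ℕ × ℕ) (L : List (ℕ × ℕ))
    (h : (p :: L).IsChain fun p q =>
      p.1 + p.2 ≤ q.1 ∧ LexGT (factor W p.1 p.2) (factor W q.1 q.2)) :
    ∃ (s : FreeMonoid α) (us : List (FreeMonoid α)), us.length = L.length ∧
      (factor W p.1 p.2 * s :: us).Pairwise LexGT ∧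
      W = factor W 0 p.1 * (factor W p.1 p.2 * s :: us).prod := by
  induction L generalizing p with
  | nil =>
    obtain ⟨s, hs⟩ := exists_eq_factor_mul W (p.1 + p.2)
    refine ⟨s, [], rfl, List.pairwise_singleton _ _, ?_⟩
    rw [List.prod_singleton, ← mul_assoc]
    rwa [factor_add, zero_add] at hs
  | cons q L ih =>
    obtain ⟨⟨hpq, hgt⟩, hL⟩ := List.isChain_cons_cons.1 h
    obtain ⟨t, us, hlen, hus, hW⟩ := ih q hL
    obtain ⟨d, hd⟩ := Nat.exists_eq_add_of_le hpq
    have hgt' : LexGT (factor W p.1 p.2 * factor W (p.1 + p.2) d) (factor W q.1 q.2 * t) :=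
      hgt.mul_right _ _
    refine ⟨factor W (p.1 + p.2) d, factor W q.1 q.2 * t :: us, congrArg (· + 1) hlen,
      List.pairwise_cons.2 ⟨fun w hw => ?_, hus⟩, ?_⟩
    · rcases List.mem_cons.1 hw with rfl | hw
      · exact hgt'
      · exact hgt'.trans ((List.pairwise_cons.1 hus).1 w hw)
    · have hsplit : factor W 0 q.1 =
          factor W 0 p.1 * (factor W p.1 p.2 * factor W (p.1 + p.2) d) := by
        rw [hd, add_assoc, factor_add, factor_add, zero_add]
      rw [List.prod_cons, ← mul_assoc, ← hsplit, ← hW]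

/-- Each factor is extended up to the start of the next one, which keeps the order since it is
decided inside the factors. -/
theorem nDivisible_of_isChain (L : List (ℕ × ℕ))
    (h : L.IsChain fun p q => p.1 + p.2 ≤ q.1 ∧ LexGT (factor W p.1 p.2) (factor W q.1 q.2)) :
    NDivisible L.length W := by
  cases L with
  | nil => exact ⟨W, [], rfl, List.Pairwise.nil, (mul_one W).symm⟩
  | cons p L =>
    obtain ⟨s, us, hlen, hus, hW⟩ := exists_eq_mul_prod_of_isChain p L h
    exact ⟨_, _, congrArg (· + 1) hlen, hus, hW⟩

end Divisibility

section Coloring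

/-- The rank of an element is the length of the longest chain that ends at it. -/
theorem exists_rank_of_isChain_length_le {ι : Type*} {r : ι → ι → Prop} {n : ℕ}
    (h : ∀ L : List ι, L.IsChain r → L.length ≤ n) :
    ∃ rank : ι → Fin n, ∀ x y, r x y → rank x < rank y := by
  classical
  let P (x : ι) (k : ℕ) : Prop := ∃ L : List ι, L.length = k ∧ (L ++ [x]).IsChain r
  have hlt (x : ι) (k : ℕ) : P x k → k < n := by
    rintro ⟨L, rfl, hL⟩
    simpa [Nat.succ_le_iff] using h _ hL
  have hP (x : ι) : P x (Nat.findGreatest (P x) n) :=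
    Nat.findGreatest_spec (Nat.zero_le n) ⟨[], rfl, List.isChain_singleton x⟩
  refine ⟨fun x => ⟨Nat.findGreatest (P x) n, hlt x _ (hP x)⟩, fun x y hxy => ?_⟩
  obtain ⟨L, hlen, hL⟩ := hP x
  have hy : P y (Nat.findGreatest (P x) n + 1) :=
    ⟨L ++ [x], by rw [List.length_append, hlen, List.length_singleton],
      hL.append (List.isChain_singleton y) (by simpa using hxy)⟩
  exact Nat.le_findGreatest (hlt y _ hy).le hy

variable {α : Type*} [LinearOrder α] {C : Type*} {W : FreeMonoid α} {n K x y : ℕ}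

/-- In the coloring `c` of the positions of `W`, the factors of length `K` that start at the
positions of any one color are disjoint and weakly increase from left to right. -/
def IsMonotoneColoring (W : FreeMonoid α) (K : ℕ) (c : ℕ → C) : Prop :=
  ∀ ⦃x y⦄, x < y → y + K ≤ W.length → c x = c y → x + K ≤ y ∧ factor W x K ≤ factor W y K

theorem add_le_of_lt_of_mod_eq (hxy : x < y) (hmod : x % K = y % K) : x + K ≤ y := by
  have hdvd : K ∣ y - x := (Nat.modEq_iff_dvd' hxy.le).1 hmod
  have := Nat.le_of_dvd (by omega) hdvd
  omega

theorem exists_isMonotoneColoring (hW : ¬ NDivisible n W) (hK : 0 < K) :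
    ∃ c : ℕ → Fin K × Fin n, IsMonotoneColoring W K c := by
  let r (x y : ℕ) : Prop :=
    x < y ∧ x % K = y % K ∧ y + K ≤ W.length ∧ factor W y K < factor W x K
  have hchain (L : List ℕ) (hL : L.IsChain r) : L.length ≤ n := by
    by_contra! hlen
    have hL' : (L.map fun x => (x, K)).IsChain fun p q =>
        p.1 + p.2 ≤ q.1 ∧ LexGT (factor W p.1 p.2) (factor W q.1 q.2) := by
      refine List.isChain_map_of_isChain _ (fun x y ⟨hxy, hmod, hy, hlt⟩ => ?_) hL
      have hle := add_le_of_lt_of_mod_eq hxy hmod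
      refine ⟨hle, lexGT_of_lt hlt ?_⟩
      rw [length_factor (by omega), length_factor (by omega)]
    exact hW ((nDivisible_of_isChain _ hL').mono (by rw [List.length_map]; omega))
  obtain ⟨rank, hrank⟩ := exists_rank_of_isChain_length_le hchain
  refine ⟨fun x => (⟨x % K, Nat.mod_lt x hK⟩, rank x), fun x y hxy hy hc => ?_⟩
  obtain ⟨hmod, heq⟩ := Prod.mk.inj hc
  replace hmod := Fin.mk.inj hmod
  refine ⟨add_le_of_lt_of_mod_eq hxy hmod, not_lt.1 fun hlt => ?_⟩
  exact (hrank x y ⟨hxy, hmod, hy, hlt⟩).ne heq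

end Coloring

section Counting

theorem card_filter_lt_add_le {R : ℕ → ℕ} (hR : Monotone R) {N k B : ℕ}
    (hB : ∀ x < N + k, R x ≤ B) : #{x ∈ range N | R x < R (x + k)} ≤ k * B := by
  have hcount : #{x ∈ range N | R x < R (x + k)} + ∑ x ∈ range N, R x ≤
      ∑ x ∈ range N, R (x + k) := by
    rw [card_filter, ← sum_add_distrib]
    refine sum_le_sum fun x _ => ?_
    have := hR (Nat.le_add_right x k)
    split_ifs <;> omega
  have hshift : ∑ x ∈ range N, R (x + k) ≤ ∑ x ∈ range N, R x + ∑ x ∈ range k, R (N + x) := by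
    rw [← sum_range_add, add_comm N k, sum_range_add]
    simp only [add_comm k]
    exact Nat.le_add_left _ _
  have htail : ∑ x ∈ range k, R (N + x) ≤ k * B := by
    simpa using sum_le_card_nsmul (range k) _ B fun x hx => hB _ (by simpa using hx)
  omega

variable {C β γ : Type*} [DecidableEq C] [LinearOrder β] [DecidableEq γ]
  {c : ℕ → C} {f : ℕ → β} {g : ℕ → γ} {M k x y : ℕ}

/-- The number of pairs (color, value of `f`) that turn up at the positions `0, …, x`. -/
def pairCount (c : ℕ → C) (f : ℕ → β) (x : ℕ) : ℕ :=
  #((range (x + 1)).image fun z => (c z, f z))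

theorem pairCount_mono (c : ℕ → C) (f : ℕ → β) : Monotone (pairCount c f) := fun x y hxy =>
  card_le_card (image_subset_image (range_subset_range.2 (by omega)))

theorem pairCount_le (hx : x < M) :
    pairCount c f x ≤ #((range M).image fun z => (c z, f z)) :=
  card_le_card (image_subset_image (range_subset_range.2 hx))

theorem one_le_pairCount (c : ℕ → C) (f : ℕ → β) (x : ℕ) : 1 ≤ pairCount c f x :=
  card_pos.2 (nonempty_range_add_one.image _)

theorem eq_of_pairCount_eq (hmono : ∀ x y, x < y → y < M → c x = c y → f x ≤ f y)
    (hx : x < M) (hy : y < M) (hc : c x = c y) (hcount : pairCount c f x = pairCount c f y) :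
    f x = f y := by
  wlog hxy : x ≤ y generalizing x y
  · exact (this hy hx hc.symm hcount.symm (by omega)).symm
  have himage : (range (x + 1)).image (fun z => (c z, f z)) =
      (range (y + 1)).image fun z => (c z, f z) :=
    eq_of_subset_of_card_le (image_subset_image (range_subset_range.2 (by omega))) hcount.ge
  have hmem : (c y, f y) ∈ (range (x + 1)).image fun z => (c z, f z) :=
    himage ▸ mem_image_of_mem _ (self_mem_range_succ y)
  obtain ⟨z, hz, hzy⟩ := mem_image.1 hmem
  obtain ⟨hcz, hfz⟩ := Prod.mk.inj hzy
  have hle {a b : ℕ} (hab : a ≤ b) (hb : b < M) (hcab : c a = c b) : f a ≤ f b :=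
    hab.eq_or_lt.elim (fun h => h ▸ le_rfl) fun h => hmono a b h hb hcab
  exact (hle hxy hy hc).antisymm
    (hfz ▸ hle (Nat.lt_succ_iff.1 (mem_range.1 hz)) hx (hcz.trans hc.symm))

theorem card_image_filter_pairCount_eq_le [Fintype C]
    (hmono : ∀ x y, x < y → y < M → c x = c y → f x ≤ f y)
    (hg : ∀ x y, f x = f y → f (x + k) = f (y + k) → g x = g y) :
    #({x ∈ range (M - k) | pairCount c f x = pairCount c f (x + k)}.image fun x => (c x, g x)) ≤
      Fintype.card C ^ 2 * #((range M).image fun x => (c x, f x)) := by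
  set G := {x ∈ range (M - k) | pairCount c f x = pairCount c f (x + k)} with hG
  set E := #((range M).image fun x => (c x, f x))
  have hle : #(G.image fun x => (c x, g x)) ≤ #((univ : Finset (C × C)) ×ˢ Icc 1 E) := by
    refine card_le_card_of_forall_subsingleton
      (fun a b => ∃ x ∈ G, a = (c x, g x) ∧ b = ((c x, c (x + k)), pairCount c f x))
      (fun a ha => ?_) ?_
    · obtain ⟨x, hx, rfl⟩ := mem_image.1 ha
      have hxM : x < M := by have := mem_range.1 (mem_filter.1 hx).1; omega
      exact ⟨_, mem_product.2 ⟨mem_univ _, mem_Icc.2 ⟨one_le_pairCount c f x, pairCount_le hxM⟩⟩,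
        x, hx, rfl, rfl⟩
    · rintro b - _ ⟨-, x, hx, rfl, rfl⟩ _ ⟨-, y, hy, rfl, hxy⟩
      simp only [hG, mem_filter, mem_range] at hx hy
      simp only [Prod.mk.injEq] at hxy ⊢
      obtain ⟨⟨hc, hck⟩, hcount⟩ := hxy
      refine ⟨hc, hg x y ?_ ?_⟩
      · exact eq_of_pairCount_eq hmono (by omega) (by omega) hc hcount
      · exact eq_of_pairCount_eq hmono (by omega) (by omega) hck
          (hx.2.symm.trans (hcount.trans hy.2))
  simpa [sq] using hle

/-- A position with `pairCount c f x = pairCount c f (x + k)` has `f x` and `f (x + k)` determined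
by this number and two colors; every other position is within distance `k` of a jump of
`pairCount c f` or of the end. -/
theorem card_image_color_prod_le [Fintype C]
    (hmono : ∀ x y, x < y → y < M → c x = c y → f x ≤ f y)
    (hg : ∀ x y, f x = f y → f (x + k) = f (y + k) → g x = g y) :
    #((range M).image fun x => (c x, g x)) ≤
      (Fintype.card C ^ 2 + 2 * k) * #((range M).image fun x => (c x, f x)) := by
  rcases M.eq_zero_or_pos with rfl | hM
  · simp
  set E := #((range M).image fun x => (c x, f x))
  let G := {x ∈ range (M - k) | pairCount c f x = pairCount c f (x + k)}
  let J := {x ∈ range (M - k) | pairCount c f x < pairCount c f (x + k)}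
  have hcover : range M ⊆ G ∪ (J ∪ Ico (M - k) M) := fun x hx => by
    have := pairCount_mono c f (Nat.le_add_right x k)
    simp only [G, J, mem_union, mem_filter, mem_range, mem_Ico] at hx ⊢
    omega
  have hJ : #J ≤ k * E := by
    rcases le_total M k with hMk | hkM
    · simp [J, Nat.sub_eq_zero_of_le hMk]
    · exact card_filter_lt_add_le (pairCount_mono c f) fun x hx => pairCount_le (by omega)
  have hE : 1 ≤ E := card_pos.2 ((nonempty_range_iff.2 hM.ne').image _)
  calc _ ≤ _ := card_le_card (image_subset_image hcover)
    _ ≤ #(G.image fun x => (c x, g x)) + (#J + #(Ico (M - k) M)) := by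
      rw [image_union]
      exact (card_union_le _ _).trans
        (Nat.add_le_add_left (card_image_le.trans (card_union_le _ _)) _)
    _ ≤ Fintype.card C ^ 2 * E + (k * E + k * E) := by
      gcongr
      · exact card_image_filter_pairCount_eq_le hmono hg
      · rw [Nat.card_Ico]
        exact le_mul_of_le_of_one_le (by omega) hE
    _ = _ := by ring

end Counting

section FactorCounting

variable {α : Type*} [LinearOrder α] [Fintype α] {C : Type*} [Fintype C] [DecidableEq C]
  {W : FreeMonoid α} {K s : ℕ} {c : ℕ → C}

theorem card_image_color_factor_le (hc : IsMonotoneColoring W K c) (hs : 2 ^ s ≤ K) :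
    #((range (W.length + 1 - K)).image fun x => (c x, factor W x (2 ^ s))) ≤
      (Fintype.card C ^ 2 + 2 * K) ^ s * (Fintype.card C * Fintype.card α) := by
  induction s with
  | zero =>
    have hsub : (range (W.length + 1 - K)).image (fun x => (c x, factor W x (2 ^ 0))) ⊆
        (univ : Finset C) ×ˢ (univ : Finset α).image FreeMonoid.of := fun p hp => by
      obtain ⟨x, hx, rfl⟩ := mem_image.1 hp
      have hx := mem_range.1 hx
      obtain ⟨a, ha⟩ := FreeMonoid.length_eq_one.1 <|
        length_factor (W := W) (x := x) (k := 2 ^ 0) (by omega)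
      exact mem_product.2 ⟨mem_univ _, mem_image.2 ⟨a, mem_univ _, ha.symm⟩⟩
    calc _ ≤ _ := card_le_card hsub
      _ ≤ _ := by
        rw [card_product, card_univ, pow_zero, one_mul]
        exact Nat.mul_le_mul_left _ card_image_le
  | succ s ih =>
    have hs' : 2 ^ s ≤ K := (Nat.pow_le_pow_right two_pos s.le_succ).trans hs
    calc _ ≤ (Fintype.card C ^ 2 + 2 * 2 ^ s) *
          #((range (W.length + 1 - K)).image fun x => (c x, factor W x (2 ^ s))) := by
          refine card_image_color_prod_le (fun x y hxy hy hcxy => ?_) fun x y h h' => ?_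
          · exact factor_le_factor hxy (by omega) hs' (hc hxy (by omega) hcxy).2
          · rw [pow_succ, mul_two, factor_add, factor_add, h, h']
      _ ≤ _ := by
          rw [pow_succ' _ s, mul_assoc]
          gcongr
          exact ih hs'

end FactorCounting

section TailsComparable

variable {α : Type*} [LinearOrder α] {W v : FreeMonoid α} {n K : ℕ}

/-- The suffixes of `v` that start at the positions `0, …, n - 1` are pairwise comparable. -/
def TailsComparable (n : ℕ) (v : FreeMonoid α) : Prop :=
  ∀ ⦃i j⦄, i < n → j < n → i ≠ j →
    LexGT (factor v i (v.length - i)) (factor v j (v.length - j)) ∨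
      LexGT (factor v j (v.length - j)) (factor v i (v.length - i))

theorem TailsComparable.exists_pairwise_lexGT (h : TailsComparable n v) :
    ∃ L : List ℕ, L.length = n ∧ (∀ i ∈ L, i < n) ∧
      L.Pairwise fun i j => LexGT (factor v i (v.length - i)) (factor v j (v.length - j)) := by
  let r (i j : ℕ) : Prop := factor v j (v.length - j) ≤ factor v i (v.length - i)
  have : Std.Total r := ⟨fun i j => le_total _ _⟩
  have : IsTrans ℕ r := ⟨fun i j k hij hjk => le_trans hjk hij⟩
  have hperm := List.perm_insertionSort r (List.range n)
  have hmem : ∀ i ∈ List.insertionSort r (List.range n), i < n := fun i hi =>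
    List.mem_range.1 (hperm.mem_iff.1 hi)
  refine ⟨List.insertionSort r (List.range n), by rw [hperm.length_eq, List.length_range], hmem, ?_⟩
  refine ((List.pairwise_insertionSort r _).and (hperm.nodup_iff.2 List.nodup_range)).imp_of_mem ?_
  rintro i j hi hj ⟨hle, hne⟩
  exact (h (hmem i hi) (hmem j hj) hne).resolve_right fun hgt => hle.not_gt hgt.lt

/-- Among `n` disjoint occurrences of `v`, the `i`-th one contains the `i`-th greatest tail of `v`,
so these tails divide `W`. -/
theorem TailsComparable.nDivisible_of_occurrences (hv : TailsComparable n v) (hn : n ≤ v.length)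
    {L : List ℕ} (hlen : L.length = n) (hdisj : L.Pairwise fun x y => x + v.length ≤ y)
    (hocc : ∀ x ∈ L, factor W x v.length = v) : NDivisible n W := by
  obtain ⟨T, hTlen, hTn, hT⟩ := hv.exists_pairwise_lexGT
  let D : List (ℕ × ℕ) := List.zipWith (fun x i => (x + i, v.length - i)) L T
  have hD : D.length = n := by rw [List.length_zipWith, hlen, hTlen, min_self]
  rw [← hD]
  refine nDivisible_of_isChain D (List.Pairwise.isChain ?_)
  rw [List.pairwise_iff_getElem] at hdisj hT ⊢
  intro i j hi hj hij
  have htail (k : ℕ) (hkL : k < L.length) (hkT : k < T.length) :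
      factor W (L[k] + T[k]) (v.length - T[k]) = factor v T[k] (v.length - T[k]) := by
    have := hTn _ (List.getElem_mem hkT)
    rw [← factor_factor (k := v.length) (by omega), hocc _ (List.getElem_mem hkL)]
  have hiT := hTn T[i] (List.getElem_mem (by omega))
  have hdisj' := hdisj i j (by omega) (by omega) hij
  simp only [D, List.getElem_zipWith]
  refine ⟨by omega, ?_⟩
  rw [htail, htail]
  exact hT i j (by omega) (by omega) hij

theorem card_lt_of_tailsComparable (hW : ¬ NDivisible n W) (hv : TailsComparable n v)
    (hn : n ≤ v.length) {X : Finset ℕ} (hdisj : ∀ x ∈ X, ∀ y ∈ X, x < y → x + v.length ≤ y)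
    (hocc : ∀ x ∈ X, factor W x v.length = v) : #X < n := by
  by_contra! hcard
  obtain ⟨Y, hYX, hY⟩ := exists_subset_card_eq hcard
  refine hW (hv.nDivisible_of_occurrences hn (L := Y.sort (· ≤ ·)) (by rw [length_sort, hY])
    ((sortedLT_sort Y).pairwise.imp_of_mem fun hx hy hxy => ?_) fun x hx => ?_)
  · exact hdisj _ (hYX ((mem_sort _).1 hx)) _ (hYX ((mem_sort _).1 hy)) hxy
  · exact hocc x (hYX ((mem_sort _).1 hx))

end TailsComparable

section Periodicity

variable {α : Type*} {W : FreeMonoid α} {n m p x k : ℕ}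

/-- `p` is a period of the factor of length `m` of `W` at position `x`. -/
def HasPeriod (W : FreeMonoid α) (p x m : ℕ) : Prop :=
  ∀ z, x ≤ z → z + p < x + m → W.toList[z]? = W.toList[z + p]?

/-- The factor of length `2 n - 1` of `W` at position `x` has a period less than `n`. This length
lets the periods at neighboring positions agree. -/
def PeriodicAt (n : ℕ) (W : FreeMonoid α) (x : ℕ) : Prop :=
  ∃ p, 1 ≤ p ∧ p < n ∧ HasPeriod W p x (2 * n - 1)

open Classical in
/-- The positions of the letters of `W` at which `W` is not periodic. -/
noncomputable def aperiodicPositions (n : ℕ) (W : FreeMonoid α) : Finset ℕ :=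
  {x ∈ range W.length | ¬ PeriodicAt n W x}

theorem mem_aperiodicPositions :
    x ∈ aperiodicPositions n W ↔ x < W.length ∧ ¬ PeriodicAt n W x := by
  simp only [aperiodicPositions, mem_filter, mem_range]

theorem HasPeriod.mono {x' m' : ℕ} (h : HasPeriod W p x m) (hx : x ≤ x')
    (hm : x' + m' ≤ x + m) : HasPeriod W p x' m' :=
  fun z hz hz' => h z (by omega) (by omega)

theorem hasPeriod_iff_factor_eq :
    HasPeriod W p x (k + p) ↔ factor W x k = factor W (x + p) k := by
  rw [factor_eq_factor_iff]
  refine ⟨fun h i hi => ?_, fun h z hz hz' => ?_⟩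
  · rw [h (x + i) (by omega) (by omega), add_right_comm]
  · have := h (z - x) (by omega)
    rwa [Nat.add_sub_cancel' hz, add_right_comm, Nat.add_sub_cancel' hz] at this

theorem exists_hasPeriod_of_forall_periodicAt (x r : ℕ)
    (h : ∀ z, x ≤ z → z ≤ x + r → PeriodicAt n W z) :
    ∃ p, 1 ≤ p ∧ p < n ∧ HasPeriod W p x (2 * n - 1 + r) := by
  induction r with
  | zero => exact h x le_rfl le_rfl
  | succ r ih =>
    obtain ⟨p, hp1, hpn, hp⟩ := ih fun z h1 h2 => h z h1 (by omega)
    obtain ⟨q, hq1, hqn, hq⟩ := h (x + (r + 1)) (by omega) le_rfl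
    refine ⟨p, hp1, hpn, fun z hz1 hz2 => ?_⟩
    by_cases hz : z + p < x + (2 * n - 1 + r)
    · exact hp z hz1 hz
    -- At the last letter, shift back by the period `q` of the new factor, where `p` is known.
    · obtain ⟨t, rfl⟩ : ∃ t, z = t + q := ⟨z - q, by omega⟩
      rw [← hq t (by omega) (by omega), hp t (by omega) (by omega),
        hq (t + p) (by omega) (by omega), add_right_comm]

theorem exists_eq_pow_mul_of_mul_eq_mul {y u t : FreeMonoid α} (hy : y ≠ 1) (h : y * u = u * t) :
    ∃ k y', u = y ^ k * y' ∧ y'.length < y.length := by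
  induction hm : u.length using Nat.strong_induction_on generalizing u with
  | _ m ih =>
    have hlen : 0 < y.length := Nat.pos_of_ne_zero (FreeMonoid.length_eq_zero.not.2 hy)
    by_cases hlt : u.length < y.length
    · exact ⟨0, u, by rw [pow_zero, one_mul], hlt⟩
    obtain ⟨v, rfl⟩ : ∃ v, u = y * v :=
      (List.prefix_of_prefix_length_le (l₃ := (y * u).toList)
        (List.prefix_append _ _) (h ▸ List.prefix_append _ _) (not_lt.1 hlt)).imp
        fun _ => Eq.symm
    rw [mul_assoc, mul_left_cancel_iff] at h
    rw [FreeMonoid.length_mul] at hm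
    obtain ⟨k, y', rfl, hy'⟩ := ih v.length (by omega) h rfl
    exact ⟨k + 1, y', by rw [pow_succ', mul_assoc], hy'⟩

end Periodicity

section Height

theorem one_mem_powProducts {M : Type*} [Monoid M] (Y : Set M) (h : ℕ) : 1 ∈ powProducts Y h :=
  ⟨[], h.zero_le, List.forall_mem_nil _, List.prod_nil.symm⟩

theorem powProducts_mono {M : Type*} [Monoid M] (Y : Set M) : Monotone (powProducts Y) :=
  fun _ _ hhk _ ⟨L, hL, hY, hx⟩ => ⟨L, hL.trans hhk, hY, hx⟩

theorem pow_mem_powProducts {M : Type*} [Monoid M] {Y : Set M} {y : M} (hy : y ∈ Y) (k : ℕ) :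
    y ^ k ∈ powProducts Y 1 :=
  ⟨[(y, k)], le_rfl, by simpa using hy, by simp⟩

theorem mem_powProducts_one {M : Type*} [Monoid M] {Y : Set M} {y : M} (hy : y ∈ Y) :
    y ∈ powProducts Y 1 := by
  simpa only [pow_one] using pow_mem_powProducts hy 1

theorem mul_mem_powProducts {M : Type*} [Monoid M] {Y : Set M} {x y : M} {h k : ℕ}
    (hx : x ∈ powProducts Y h) (hy : y ∈ powProducts Y k) : x * y ∈ powProducts Y (h + k) := by
  obtain ⟨L, hL, hLY, rfl⟩ := hx
  obtain ⟨L', hL', hLY', rfl⟩ := hy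
  refine ⟨L ++ L', by rw [List.length_append]; omega, fun p hp => ?_, by simp⟩
  exact (List.mem_append.1 hp).elim (hLY p) (hLY' p)

variable {α : Type*} {W : FreeMonoid α} {n x k : ℕ}

theorem factor_mem_powProducts_of_forall_periodicAt (hn : 0 < n)
    (h : ∀ z, x ≤ z → z < x + k → PeriodicAt n W z) :
    factor W x k ∈ powProducts (shortWords α n) 2 := by
  rcases k with - | r
  · exact one_mem_powProducts _ _
  obtain ⟨p, hp1, hpn, hp⟩ := exists_hasPeriod_of_forall_periodicAt (W := W) (n := n) x r
    fun z h1 h2 => h z h1 (by omega)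
  have heq := hasPeriod_iff_factor_eq.1 (hp.mono le_rfl (show x + (r + 1 + p) ≤ _ by omega))
  have hmul : factor W x p * factor W x (r + 1) =
      factor W x (r + 1) * factor W (x + (r + 1)) p := by
    rw [heq, ← factor_add, ← heq, ← factor_add, add_comm]
  by_cases hy : factor W x p = 1
  · have hdrop : W.toList.drop x = [] :=
      (List.take_eq_nil_iff.1 hy).resolve_left (Nat.one_le_iff_ne_zero.1 hp1)
    rw [factor, hdrop, List.take_nil]
    exact one_mem_powProducts _ _
  obtain ⟨k, y', hk, hy'⟩ := exists_eq_pow_mul_of_mul_eq_mul hy hmul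
  have hlen := length_factor_le W x p
  rw [hk]
  exact mul_mem_powProducts (pow_mem_powProducts (Y := shortWords α n) (hlen.trans_lt hpn) k)
    (mem_powProducts_one ((hy'.trans_le hlen).trans hpn))

theorem exists_factor_zero_mem_powProducts (hn : 2 ≤ n) (hk : k ≤ W.length) :
    ∃ x ≤ k, (∀ z, x ≤ z → z < k → PeriodicAt n W z) ∧
      factor W 0 x ∈ powProducts (shortWords α n) (3 * #{z ∈ aperiodicPositions n W | z < x}) := by
  induction k with
  | zero => exact ⟨0, le_rfl, by omega, one_mem_powProducts _ _⟩
  | succ k ih =>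
    obtain ⟨x, hxk, hrun, hx⟩ := ih (by omega)
    by_cases hk' : PeriodicAt n W k
    · refine ⟨x, by omega, fun z h1 h2 => ?_, hx⟩
      rcases (Nat.lt_succ_iff.1 h2).eq_or_lt with rfl | h2
      exacts [hk', hrun z h1 h2]
    refine ⟨k + 1, le_rfl, by omega, ?_⟩
    have hcard : #{z ∈ aperiodicPositions n W | z < x} + 1 ≤
        #{z ∈ aperiodicPositions n W | z < k + 1} := by
      refine card_lt_card (ssubset_iff_of_subset (fun z hz => ?_) |>.2 ⟨k, ?_, ?_⟩)
      · have hz := mem_filter.1 hz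
        exact mem_filter.2 ⟨hz.1, by omega⟩
      · exact mem_filter.2 ⟨mem_aperiodicPositions.2 ⟨hk, hk'⟩, k.lt_succ_self⟩
      · exact fun hk => (mem_filter.1 hk).2.not_ge hxk
    have hsplit : factor W 0 (k + 1) = factor W 0 x * factor W x (k - x) * factor W k 1 := by
      rw [factor_add, ← Nat.add_sub_cancel' hxk]
      simp [factor_add]
    rw [hsplit]
    refine powProducts_mono _ (by omega) (mul_mem_powProducts (mul_mem_powProducts hx
      (factor_mem_powProducts_of_forall_periodicAt (by omega) fun z h1 h2 => hrun z h1 (by omega)))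
      (mem_powProducts_one ?_))
    exact (length_factor_le W k 1).trans_lt hn

theorem mem_powProducts_aperiodicPositions (hn : 2 ≤ n) (W : FreeMonoid α) :
    W ∈ powProducts (shortWords α n) (3 * #(aperiodicPositions n W) + 2) := by
  obtain ⟨x, hx, hrun, hmem⟩ := exists_factor_zero_mem_powProducts hn (le_refl W.length)
  have hW : W = factor W 0 x * factor W x (W.length - x) := by
    conv_lhs => rw [← factor_zero_length W, ← Nat.add_sub_cancel' hx, factor_add, zero_add]
  have := mul_mem_powProducts hmem
    (factor_mem_powProducts_of_forall_periodicAt (k := W.length - x) (by omega)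
      fun z h1 h2 => hrun z h1 (by omega))
  rw [← hW] at this
  exact powProducts_mono _ (by gcongr; exact filter_subset _ _) this

end Height

section Aperiodic

variable {α : Type*} [LinearOrder α] {W : FreeMonoid α} {n K s y i j : ℕ}

theorem hasPeriod_or_lexGT_factor (hij : i < j) (hjK : j ≤ K) (hy : y + K ≤ W.length) :
    HasPeriod W (j - i) (y + i) (K - i) ∨
      LexGT (factor W (y + i) (K - i)) (factor W (y + j) (K - j)) ∨
      LexGT (factor W (y + j) (K - j)) (factor W (y + i) (K - i)) := by
  have hi : (factor W (y + i) (K - i)).length = K - i := length_factor (by omega)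
  have hj : (factor W (y + j) (K - j)).length = K - j := length_factor (by omega)
  rcases lexGT_trichotomy (factor W (y + i) (K - i)) (factor W (y + j) (K - j))
    with hgt | hgt | ⟨t, ht⟩ | ⟨t, ht⟩
  · exact .inr (.inl hgt)
  · exact .inr (.inr hgt)
  · rw [ht, FreeMonoid.length_mul] at hj
    omega
  · have hK : K - i = K - j + (j - i) := by omega
    rw [hK, factor_add] at ht
    rw [hK, hasPeriod_iff_factor_eq, show y + i + (j - i) = y + j by omega]
    refine .inl (List.append_inj_left ht ?_)
    exact (length_factor (W := W) (by omega)).trans hj.symm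

theorem tailsComparable_of_not_periodicAt (hK : 3 * n ≤ K) (hy : y + K ≤ W.length)
    (h : ¬ PeriodicAt n W (y + (n - 1))) : TailsComparable n (factor W y K) := by
  have hlexGT {i j : ℕ} (hij : i < j) (hj : j < n) :
      LexGT (factor W (y + i) (K - i)) (factor W (y + j) (K - j)) ∨
        LexGT (factor W (y + j) (K - j)) (factor W (y + i) (K - i)) := by
    refine (hasPeriod_or_lexGT_factor hij (by omega) hy).resolve_left fun hp => h ?_
    exact ⟨j - i, by omega, by omega, hp.mono (by omega) (by omega)⟩
  intro i j hi hj hij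
  rw [length_factor hy, factor_factor (by omega), factor_factor (by omega)]
  rcases hij.lt_or_gt with hij | hij
  exacts [hlexGT hij hj, (hlexGT hij hi).symm]

variable [Fintype α] {C : Type*} [Fintype C]

open Classical in
theorem card_filter_tailsComparable_le {c : ℕ → C} (hc : IsMonotoneColoring W (2 ^ s) c)
    (hW : ¬ NDivisible n W) (hn : n ≤ 2 ^ s) :
    #{y ∈ range (W.length + 1 - 2 ^ s) | TailsComparable n (factor W y (2 ^ s))} ≤
      n * ((Fintype.card C ^ 2 + 2 * 2 ^ s) ^ s * (Fintype.card C * Fintype.card α)) := by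
  set T := {y ∈ range (W.length + 1 - 2 ^ s) | TailsComparable n (factor W y (2 ^ s))}
  have hfit : ∀ y ∈ T, y + 2 ^ s ≤ W.length := fun y hy => by
    have := mem_range.1 (mem_filter.1 hy).1
    omega
  calc #T ≤ n * #(T.image fun x => (c x, factor W x (2 ^ s))) := by
        refine card_le_mul_card_image T n fun a ha => ?_
        obtain ⟨x, hx, rfl⟩ := mem_image.1 ha
        have hlen := length_factor (hfit x hx)
        refine (card_lt_of_tailsComparable hW (mem_filter.1 hx).2 (by rwa [hlen])
          (fun y hy z hz hyz => ?_) fun y hy => ?_).le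
        · rw [mem_filter, Prod.mk.injEq] at hy hz
          rw [hlen]
          exact (hc hyz (hfit z hz.1) (hy.2.1.trans hz.2.1.symm)).1
        · rw [mem_filter, Prod.mk.injEq] at hy
          rw [hlen, hy.2.2]
    _ ≤ _ := by
        gcongr
        exact (card_le_card (image_subset_image (filter_subset _ _))).trans
          (card_image_color_factor_le hc le_rfl)

theorem card_aperiodicPositions_le (hn : 3 * n ≤ 2 ^ s) (hW : ¬ NDivisible n W) :
    #(aperiodicPositions n W) ≤ 2 ^ s +
      n * (((2 ^ s * n) ^ 2 + 2 * 2 ^ s) ^ s * (2 ^ s * n * Fintype.card α)) := by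
  classical
  obtain ⟨c, hc⟩ := exists_isMonotoneColoring hW (Nat.two_pow_pos s)
  set M := W.length + 1 - 2 ^ s
  have hT := card_filter_tailsComparable_le hc hW (by omega)
  set T := {y ∈ range M | TailsComparable n (factor W y (2 ^ s))}
  have hsub : aperiodicPositions n W ⊆
      (range (n - 1) ∪ Ico (M + (n - 1)) W.length) ∪ T.image (· + (n - 1)) := fun x hx => by
    obtain ⟨hxW, hx⟩ := mem_aperiodicPositions.1 hx
    rw [mem_union, mem_union, mem_range, mem_Ico]
    by_cases hmid : n - 1 ≤ x ∧ x < M + (n - 1)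
    · refine .inr (mem_image.2 ⟨x - (n - 1), mem_filter.2 ⟨mem_range.2 (by omega), ?_⟩, by omega⟩)
      refine tailsComparable_of_not_periodicAt hn (by omega) ?_
      rwa [Nat.sub_add_cancel hmid.1]
    · exact .inl (by omega)
  calc #(aperiodicPositions n W) ≤ _ := card_le_card hsub
    _ ≤ (n - 1 + (W.length - (M + (n - 1)))) + #T := by
      refine (card_union_le _ _).trans (Nat.add_le_add ?_ card_image_le)
      simpa only [card_range, Nat.card_Ico] using
        card_union_le (range (n - 1)) (Ico (M + (n - 1)) W.length)
    _ ≤ _ := by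
      rw [Fintype.card_prod, Fintype.card_fin, Fintype.card_fin] at hT
      exact Nat.add_le_add (by omega) hT

end Aperiodic

section HeightBound

theorem logb_three_pos {n : ℕ} (hn : 2 ≤ n) : 0 < Real.logb 3 n :=
  Real.logb_pos (by norm_num) (by exact_mod_cast hn)

theorem neg_one_le_logb_logb {n : ℕ} (hn : 2 ≤ n) : -1 ≤ Real.logb 3 (Real.logb 3 n) := by
  have hlog : 1 ≤ 3 * Real.logb 3 n := by
    rw [← Nat.cast_ofNat (R := ℝ) (n := 3), ← Real.logb_pow,
      Real.le_logb_iff_rpow_le (by norm_num) (by positivity), Real.rpow_one]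
    exact_mod_cast (show 3 ≤ n ^ 3 by linarith [Nat.pow_le_pow_left hn 3])
  rw [Real.le_logb_iff_rpow_le (by norm_num) (logb_three_pos hn), Real.rpow_neg_one]
  linarith

theorem natCast_le_logb_of_two_pow_le {n s : ℕ} (hn : 2 ≤ n) (hs : 2 ^ s ≤ 6 * n) :
    (s : ℝ) ≤ 4 + 2 * Real.logb 3 n := by
  have hpow : 3 ^ s ≤ 3 ^ 4 * n ^ 2 := by
    calc 3 ^ s ≤ (2 ^ 2) ^ s := Nat.pow_le_pow_left (by norm_num) s
      _ = (2 ^ s) ^ 2 := pow_right_comm 2 2 s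
      _ ≤ (6 * n) ^ 2 := Nat.pow_le_pow_left hs 2
      _ ≤ 3 ^ 4 * n ^ 2 := by nlinarith
  have hlog := Real.logb_le_logb_of_le (b := 3) (by norm_num) (by positivity)
    (show (3 : ℝ) ^ s ≤ 3 ^ 4 * n ^ 2 by exact_mod_cast hpow)
  rw [Real.logb_mul (by positivity) (by positivity), Real.logb_pow, Real.logb_pow,
    Real.logb_pow, Real.logb_self_eq_one (by norm_num)] at hlog
  simpa only [mul_one, Nat.cast_ofNat] using hlog

theorem pow_mul_le_Phi {n s : ℕ} (l : ℕ) (hn : 2 ≤ n) (hs : 2 ^ s ≤ 6 * n) :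
    2 ^ 20 * l * n ^ 9 * (n ^ s) ^ 4 ≤ Phi n l := by
  have hpow : (n : ℝ) ^ 9 * (n ^ s) ^ 4 = (n : ℝ) ^ (9 + 4 * s : ℝ) := by
    rw [← pow_mul, ← pow_add, ← Real.rpow_natCast]
    push_cast
    ring_nf
  rw [mul_assoc, hpow, Phi]
  have := natCast_le_logb_of_two_pow_le hn hs
  have := neg_one_le_logb_logb hn
  have := logb_three_pos hn
  gcongr ?_ * l * (n : ℝ) ^ ?_
  · norm_num
  · exact_mod_cast (by omega : 1 ≤ n)
  · linarith

theorem height_le_pow_mul {n l s : ℕ} (hn : 2 ≤ n) (hl : 1 ≤ l) (hs : 2 ^ s ≤ 6 * n) :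
    3 * (2 ^ s + n * (((2 ^ s * n) ^ 2 + 2 * 2 ^ s) ^ s * (2 ^ s * n * l))) + 2 ≤
      2 ^ 20 * l * n ^ 9 * (n ^ s) ^ 4 := by
  have hbase : (2 ^ s * n) ^ 2 + 2 * 2 ^ s ≤ 2 ^ 6 * n ^ 4 := by
    have hn3 : 2 ^ 3 ≤ n ^ 3 := Nat.pow_le_pow_left hn 3
    calc (2 ^ s * n) ^ 2 + 2 * 2 ^ s ≤ (6 * n * n) ^ 2 + 2 * (6 * n) := by gcongr
      _ ≤ 2 ^ 6 * n ^ 4 := by nlinarith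
  have hpow : ((2 ^ s * n) ^ 2 + 2 * 2 ^ s) ^ s ≤ (6 * n) ^ 6 * (n ^ s) ^ 4 := by
    calc _ ≤ (2 ^ 6 * n ^ 4) ^ s := Nat.pow_le_pow_left hbase s
      _ = (2 ^ s) ^ 6 * (n ^ s) ^ 4 := by rw [mul_pow, pow_right_comm 2 6 s, pow_right_comm n 4 s]
      _ ≤ _ := by gcongr
  have hone : n ≤ n ^ 9 * (n ^ s) ^ 4 * l := by
    calc n = n ^ 1 * 1 ^ 4 * 1 := by ring
      _ ≤ _ := by
        gcongr
        · omega
        · norm_num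
        · exact Nat.one_le_pow _ _ (by omega)
  calc _ ≤ 3 * (6 * n + n * ((6 * n) ^ 6 * (n ^ s) ^ 4 * (6 * n * n * l))) + n := by gcongr
    _ = 19 * n + 18 * 6 ^ 6 * (n ^ 9 * (n ^ s) ^ 4 * l) := by ring
    _ ≤ 2 ^ 20 * (n ^ 9 * (n ^ s) ^ 4 * l) := by omega
    _ = _ := by ring

theorem exists_height_bound (α : Type*) [LinearOrder α] [Fintype α] {n : ℕ} (hn : 2 ≤ n) :
    ∃ k : ℕ, {W : FreeMonoid α | ¬ NDivisible n W} ⊆ powProducts (shortWords α n) k ∧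
      (k : ℝ) ≤ Phi n (Fintype.card α) := by
  rcases isEmpty_or_nonempty α with hα | hα
  · refine ⟨0, fun W _ => ?_, by simp [Phi]⟩
    rw [Subsingleton.elim W 1]
    exact one_mem_powProducts _ _
  have hs : 2 ^ Nat.log 2 (6 * n) ≤ 6 * n := Nat.pow_log_le_self 2 (by omega)
  have hs' : 3 * n ≤ 2 ^ Nat.log 2 (6 * n) := by
    have := Nat.lt_pow_succ_log_self one_lt_two (6 * n)
    rw [pow_succ] at this
    omega
  have hk := height_le_pow_mul hn (Fintype.card_pos (α := α)) hs
  refine ⟨_, fun W hW => ?_, (Nat.cast_le.2 hk).trans ?_⟩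
  · refine powProducts_mono _ ?_ (mem_powProducts_aperiodicPositions hn W)
    exact Nat.add_le_add_right (Nat.mul_le_mul_left 3 (card_aperiodicPositions_le hs' hW)) 2
  · exact_mod_cast pow_mul_le_Phi _ hn hs

theorem exists_isLeast_le {s : Set ℕ} {k : ℕ} (hk : k ∈ s) : ∃ h, IsLeast s h ∧ h ≤ k :=
  ⟨sInf s, isLeast_csInf ⟨k, hk⟩, Nat.sInf_le hk⟩

theorem exists_isSetHeight (α : Type*) [LinearOrder α] [Fintype α] {n : ℕ} (hn : 2 ≤ n) :
    ∃ h : ℕ, IsSetHeight {W : FreeMonoid α | ¬ NDivisible n W} (shortWords α n) h ∧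
      (h : ℝ) ≤ Phi n (Fintype.card α) := by
  obtain ⟨k, hk, hkΦ⟩ := exists_height_bound α hn
  obtain ⟨h, hh, hhk⟩ : ∃ h, IsSetHeight {W : FreeMonoid α | ¬ NDivisible n W} (shortWords α n) h ∧
      h ≤ k := exists_isLeast_le hk
  exact ⟨h, hh, (Nat.cast_le.2 hhk).trans hkΦ⟩

end HeightBound

section Asymptotics

open Filter Topology Asymptotics

theorem Phi_eq_mul (n l : ℕ) : Phi n l = l * Phi n 1 := by
  simp only [Phi, Nat.cast_one]
  ring

theorem tendsto_logb_natCast : Tendsto (fun n : ℕ => Real.logb 3 n) atTop atTop :=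
  (Real.tendsto_logb_atTop (by norm_num)).comp tendsto_natCast_atTop_atTop

theorem isLittleO_logb_logb (a : ℝ) :
    (fun n : ℕ => a / Real.logb 3 n + 36 * Real.logb 3 (Real.logb 3 n) + 91) =o[atTop]
      fun n : ℕ => Real.logb 3 n := by
  have hconst (b : ℝ) : (fun _ : ℕ => b) =o[atTop] fun n : ℕ => Real.logb 3 n :=
    isLittleO_const_left.2 (.inr (tendsto_norm_atTop_atTop.comp tendsto_logb_natCast))
  have hinv : (fun n : ℕ => a / Real.logb 3 n) =o[atTop] fun n : ℕ => Real.logb 3 n :=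
    ((tendsto_logb_natCast.const_div_atTop a).isBigO_one ℝ).trans_isLittleO (hconst 1)
  have hlog : (fun n : ℕ => Real.logb 3 (Real.logb 3 n)) =o[atTop] fun n : ℕ => Real.logb 3 n :=
    by simpa only [Real.logb, div_eq_inv_mul, Function.comp_def, id] using
      (Real.isLittleO_log_id_atTop.comp_tendsto tendsto_logb_natCast).const_mul_left (Real.log 3)⁻¹
  exact (hinv.add (hlog.const_mul_left 36)).add (hconst 91)

theorem exists_Phi_eq_rpow {l : ℕ} (hl : 1 ≤ l) :
    ∃ ε : ℕ → ℝ, Tendsto ε atTop (𝓝 0) ∧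
      ∀ n : ℕ, 2 ≤ n → Phi n l = (n : ℝ) ^ (12 * (1 + ε n) * Real.logb 3 n) := by
  set a := Real.logb 3 (2 ^ 96 * l) with ha
  refine ⟨fun n => (a / Real.logb 3 n + 36 * Real.logb 3 (Real.logb 3 n) + 91) /
    Real.logb 3 n * 12⁻¹, ?_, fun n hn => ?_⟩
  · simpa only [zero_mul] using (isLittleO_logb_logb a).tendsto_div_nhds_zero.mul_const 12⁻¹
  have hL := logb_three_pos hn
  have hn0 : (0 : ℝ) < n := by positivity
  have hn1 : (n : ℝ) ≠ 1 := by exact_mod_cast (by omega : n ≠ 1)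
  have ha' : (n : ℝ) ^ (a / Real.logb 3 n) = 2 ^ 96 * l := by
    rw [ha, Real.logb, Real.logb, div_div_div_cancel_right₀ (Real.log_pos (by norm_num)).ne']
    exact Real.rpow_logb hn0 hn1 (by positivity)
  rw [Phi, ← ha', ← Real.rpow_add hn0]
  congr 1
  field_simp
  ring

theorem exp_isLittleO_pow {g : ℕ → ℝ} (hg : g =o[atTop] fun n : ℕ => (n : ℝ)) {c : ℝ}
    (hc : 1 < c) : (fun n => Real.exp (g n)) =o[atTop] fun n : ℕ => c ^ n := by
  have hlog : 0 < Real.log c := Real.log_pos hc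
  have hpow (n : ℕ) : c ^ n = Real.exp (n * Real.log c) := by
    rw [Real.exp_nat_mul, Real.exp_log (by linarith)]
  simp only [hpow, Real.isLittleO_exp_comp_exp_comp]
  have hequiv : (fun n : ℕ => n * Real.log c - g n) ~[atTop] fun n : ℕ => n * Real.log c :=
    IsEquivalent.refl.sub_isLittleO <| hg.trans_isBigO <|
      (isBigO_self_const_mul hlog.ne' _ _).congr_right fun n => mul_comm _ _
  exact hequiv.symm.tendsto_atTop (tendsto_natCast_atTop_atTop.atTop_mul_const hlog)

theorem pow_mul_Phi_isLittleO (j l : ℕ) {c : ℝ} (hc : 1 < c) :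
    (fun n : ℕ => (n : ℝ) ^ j * Phi n l) =o[atTop] fun n : ℕ => c ^ n := by
  rcases Nat.eq_zero_or_pos l with rfl | hl
  · simpa only [Phi, Nat.cast_zero, mul_zero, zero_mul] using isLittleO_zero _ _
  obtain ⟨ε, hε, hPhi⟩ := exists_Phi_eq_rpow hl
  have hO : (fun n : ℕ => Real.log n * (j + 12 * (1 + ε n) * Real.logb 3 n)) =O[atTop]
      fun n : ℕ => Real.log n ^ 2 := by
    have hlogb : (fun n : ℕ => Real.logb 3 n) =O[atTop] fun n : ℕ => Real.log n := by
      simpa only [Real.logb, div_eq_inv_mul] using (isBigO_refl _ _).const_mul_left (Real.log 3)⁻¹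
    have hj : (fun _ : ℕ => (j : ℝ)) =O[atTop] fun n : ℕ => Real.log n :=
      (Real.isLittleO_const_log_atTop.comp_tendsto tendsto_natCast_atTop_atTop).isBigO
    have hε' := ((hε.const_add 1).const_mul 12).isBigO_one ℝ
    simpa only [sq, one_mul] using
      (isBigO_refl _ _).mul (hj.add ((hε'.mul hlogb).congr_right fun n => one_mul _))
  have hlog : (fun n : ℕ => Real.log n ^ 2) =o[atTop] fun n : ℕ => (n : ℝ) :=
    (Real.isLittleO_pow_log_id_atTop (n := 2)).comp_tendsto tendsto_natCast_atTop_atTop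
  refine (exp_isLittleO_pow (hO.trans_isLittleO hlog) hc).congr' ?_ .rfl
  filter_upwards [eventually_ge_atTop 2] with n hn
  have hn0 : (0 : ℝ) < n := by positivity
  rw [hPhi n hn, ← Real.rpow_def_of_pos hn0, Real.rpow_add hn0, Real.rpow_natCast]

end Asymptotics

section Linearization

variable {B : Type*} [Ring B] {d e : ℕ}

open Classical in
/-- The full polarization of the monomial with variables `w 0, …, w (e - 1)`: the elements `y j`
are substituted for the variables `u j`, in all ways that use each of the `y j` at least once. -/
noncomputable def polarization (u : Fin d → ℕ) (y : Fin d → B) (w : Fin e → ℕ) : B :=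
  ∑ φ : Fin e → Fin d with Function.Surjective φ ∧ u ∘ φ = w, (List.ofFn (y ∘ φ)).prod

theorem lift_sum_ofFn (T : Finset (Fin d)) (u : Fin d → ℕ) (y : Fin d → B) (w : Fin e → ℕ) :
    FreeMonoid.lift (fun i => ∑ j ∈ T with u j = i, y j) (FreeMonoid.ofList (List.ofFn w)) =
      ∑ φ : Fin e → Fin d with (∀ t, φ t ∈ T) ∧ u ∘ φ = w, (List.ofFn (y ∘ φ)).prod := by
  have hexpand := (MultilinearMap.mkPiAlgebraFin ℤ e B).map_sum_finset (fun _ j => y j)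
    fun t => {j ∈ T | u j = w t}
  simp only [MultilinearMap.mkPiAlgebraFin_apply] at hexpand
  rw [FreeMonoid.lift_ofList, List.map_ofFn]
  refine hexpand.trans (sum_congr ?_ fun _ _ => rfl)
  ext φ
  simp only [Fintype.mem_piFinset, mem_filter, mem_univ, true_and, funext_iff,
    Function.comp_apply, forall_and]

theorem polarization_eq_sum (u : Fin d → ℕ) (y : Fin d → B) (w : Fin e → ℕ) :
    polarization u y w = ∑ T : Finset (Fin d), (-1 : ℤ) ^ #T •
      FreeMonoid.lift (fun i => ∑ j ∈ Tᶜ with u j = i, y j) (FreeMonoid.ofList (List.ofFn w)) := by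
  classical
  have h := inclusion_exclusion_sum_inf_compl (univ : Finset (Fin d))
    (fun j => {φ : Fin e → Fin d | ∀ t, φ t ≠ j})
    fun φ => if u ∘ φ = w then (List.ofFn (y ∘ φ)).prod else 0
  simp only [← sum_filter, powerset_univ] at h
  rw [polarization]
  refine (sum_congr ?_ fun _ _ => rfl).trans (h.trans (sum_congr rfl fun T _ => ?_))
  · ext φ
    rw [mem_filter, mem_filter]
    simp only [Function.Surjective, mem_filter, mem_inf, mem_compl, mem_univ, true_and,
      true_imp_iff, not_forall, not_not]
  · rw [lift_sum_ofFn]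
    refine congrArg _ (sum_congr ?_ fun _ _ => rfl)
    ext φ
    simp only [mem_filter, mem_inf, mem_univ, true_and, mem_compl, and_congr_left_iff]
    exact fun _ => ⟨fun h t hT => h _ hT t rfl, fun h j hj t htj => h t (htj ▸ hj)⟩

theorem polarization_eq_zero (u : Fin d → ℕ) (y : Fin d → B) (w : Fin e → ℕ) (he : e < d) :
    polarization u y w = 0 := by
  rw [polarization, filter_false_of_mem fun φ _ hφ => ?_, sum_empty]
  have hcard := Fintype.card_le_of_surjective φ hφ.1
  rw [Fintype.card_fin, Fintype.card_fin] at hcard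
  exact he.not_ge hcard

theorem polarization_eq_sum_perm (u : Fin d → ℕ) (y : Fin d → B) (w : Fin d → ℕ) :
    polarization u y w =
      ∑ σ : Equiv.Perm (Fin d), if u ∘ σ = w then (List.ofFn (y ∘ σ)).prod else 0 := by
  rw [polarization, ← sum_filter]
  symm
  refine sum_bij (fun σ _ => ⇑σ) (fun σ hσ => ?_) (fun σ _ τ _ h => DFunLike.coe_injective h)
    (fun φ hφ => ?_) fun _ _ => rfl
  · exact mem_filter.2 ⟨mem_univ _, σ.surjective, (mem_filter.1 hσ).2⟩
  · obtain ⟨-, hsurj, hφ⟩ := mem_filter.1 hφ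
    exact ⟨Equiv.ofBijective φ (Finite.injective_iff_bijective.1
      (Finite.injective_iff_surjective.2 hsurj)), mem_filter.2 ⟨mem_univ _, hφ⟩, rfl⟩

theorem polarization_get_eq_sum_perm (u : Fin d → ℕ) (y : Fin d → B) {v : FreeMonoid ℕ}
    (hv : v.length ≤ d) :
    polarization u y v.toList.get = ∑ σ : Equiv.Perm (Fin d),
      if FreeMonoid.ofList (List.ofFn (u ∘ σ)) = v then (List.ofFn (y ∘ σ)).prod else 0 := by
  rcases hv.lt_or_eq with hv | hv
  · refine (polarization_eq_zero u y v.toList.get hv).trans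
      (sum_eq_zero fun σ _ => if_neg ?_).symm
    rintro rfl
    simp [FreeMonoid.length] at hv
  · obtain rfl : v.toList.length = d := hv
    rw [polarization_eq_sum_perm]
    refine sum_congr rfl fun σ _ => if_congr ?_ rfl rfl
    rw [← List.ofFn_injective.eq_iff, List.ofFn_get]
    rfl

theorem list_prod_mem_of_ne_nil {M σ : Type*} [Monoid M] [SetLike σ M] [MulMemClass σ M] {S : σ}
    {L : List M} (hL : L ≠ []) (h : ∀ x ∈ L, x ∈ S) : L.prod ∈ S := by
  induction L with
  | nil => exact absurd rfl hL
  | cons a L ih =>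
    have ha := h a List.mem_cons_self
    rcases eq_or_ne L [] with rfl | hL'
    · rwa [List.prod_singleton]
    · rw [List.prod_cons]
      exact mul_mem ha (ih hL' fun x hx => h x (List.mem_cons_of_mem _ hx))

theorem polarization_mem {σ : Type*} [SetLike σ B] [NonUnitalSubsemiringClass σ B] {S : σ}
    (u : Fin d → ℕ) {y : Fin d → B} (hy : ∀ j, y j ∈ S) (w : Fin e → ℕ) (he : e ≠ 0) :
    polarization u y w ∈ S := by
  refine sum_mem fun φ _ => list_prod_mem_of_ne_nil (mt List.ofFn_eq_nil_iff.1 he) ?_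
  exact List.forall_mem_ofFn_iff.2 fun t => hy (φ t)

variable {K : Type*} [CommRing K] [Algebra K B] {f : NCPoly K}

theorem NCPoly.eval_eq_sum (x : ℕ → B) (f : NCPoly K) :
    f.eval x = ∑ v ∈ f.coeff.support, f.coeff v • FreeMonoid.lift x v := by
  rw [NCPoly.eval, MonoidAlgebra.lift_apply, Finsupp.sum]

theorem sum_coeff_smul_polarization {σ : Type*} [SetLike σ B] [AddSubmonoidClass σ B] {S : σ}
    (hf : ∀ x : ℕ → B, (∀ i, x i ∈ S) → f.eval x = 0) (u : Fin d → ℕ) {y : Fin d → B}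
    (hy : ∀ j, y j ∈ S) :
    ∑ v ∈ f.coeff.support, f.coeff v • polarization u y v.toList.get = 0 := by
  have hT (T : Finset (Fin d)) : f.eval (fun i => ∑ j ∈ Tᶜ with u j = i, y j) = 0 :=
    hf _ fun i => sum_mem fun j _ => hy j
  have h : ∑ T : Finset (Fin d), (-1 : ℤ) ^ #T •
      f.eval (fun i => ∑ j ∈ Tᶜ with u j = i, y j) = 0 := by
    simp only [hT, smul_zero, sum_const_zero]
  simp only [NCPoly.eval_eq_sum, smul_sum] at h
  rw [sum_comm] at h
  rw [← h]
  refine sum_congr rfl fun v _ => ?_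
  rw [polarization_eq_sum, List.ofFn_get, FreeMonoid.ofList_toList, smul_sum]
  exact sum_congr rfl fun T _ => smul_comm _ _ _

theorem sum_perm_add_sum_polarization {σ : Type*} [SetLike σ B] [AddSubmonoidClass σ B] {S : σ}
    (hf : ∀ x : ℕ → B, (∀ i, x i ∈ S) → f.eval x = 0) (u : Fin d → ℕ) {y : Fin d → B}
    (hy : ∀ j, y j ∈ S) :
    (∑ σ : Equiv.Perm (Fin d),
        f.coeff (FreeMonoid.ofList (List.ofFn (u ∘ σ))) • (List.ofFn (y ∘ σ)).prod) +
      ∑ v ∈ f.coeff.support with d < v.length, f.coeff v • polarization u y v.toList.get = 0 := by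
  classical
  rw [← sum_coeff_smul_polarization hf u hy, add_comm,
    ← sum_filter_add_sum_filter_not f.coeff.support fun v : FreeMonoid ℕ => d < v.length]
  congr 1
  have hlow : ∀ v ∈ f.coeff.support.filter fun v => ¬ d < v.length,
      f.coeff v • polarization u y v.toList.get = ∑ σ : Equiv.Perm (Fin d),
        if FreeMonoid.ofList (List.ofFn (u ∘ σ)) = v then
          f.coeff v • (List.ofFn (y ∘ σ)).prod else 0 := fun v hv => by
    rw [polarization_get_eq_sum_perm u y (not_lt.1 (mem_filter.1 hv).2), smul_sum]
    simp only [smul_ite, smul_zero]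
  rw [sum_congr rfl hlow, sum_comm]
  refine sum_congr rfl fun σ _ => ?_
  rw [sum_ite_eq]
  split_ifs with h
  · rfl
  · have hlen : ¬ d < (FreeMonoid.ofList (List.ofFn (u ∘ σ))).length := by
      simp [FreeMonoid.length]
    rw [Finsupp.notMem_support_iff.1 fun hmem => h (mem_filter.2 ⟨hmem, hlen⟩), zero_smul]

end Linearization

section Division

variable {α : Type*} [LinearOrder α] {u v : FreeMonoid α}

theorem LexGT.left_ne_one (h : LexGT u v) : u ≠ 1 := by
  obtain ⟨p, s, -, a, -, -, rfl, -⟩ := h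
  intro h
  simpa using congrArg FreeMonoid.length h

theorem LexGT.right_ne_one (h : LexGT u v) : v ≠ 1 := by
  obtain ⟨p, -, t, -, b, -, -, rfl⟩ := h
  intro h
  simpa using congrArg FreeMonoid.length h

theorem NDivisible.exists_ofFn {d : ℕ} {W : FreeMonoid α} (h : NDivisible d W) :
    ∃ (v : FreeMonoid α) (w : Fin d → FreeMonoid α), (List.ofFn w).Pairwise LexGT ∧
      W = v * (List.ofFn w).prod ∧ ∀ i, w i ≠ 1 ∨ w i = W := by
  obtain ⟨v, us, rfl, hus, hW⟩ := h
  by_cases hd : us.length = 1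
  · rw [hd]
    exact ⟨1, fun _ => W, List.pairwise_singleton _ _, by simp, fun _ => .inr rfl⟩
  · refine ⟨v, us.get, by rwa [List.ofFn_get], by rwa [List.ofFn_get], fun i => .inl ?_⟩
    have : Nontrivial (Fin us.length) := Fin.nontrivial_iff_two_le.2 (by have := i.2; omega)
    obtain ⟨j, hj⟩ := exists_ne i
    rcases hj.lt_or_gt with hji | hij
    · exact (List.pairwise_iff_get.1 hus j i hji).right_ne_one
    · exact (List.pairwise_iff_get.1 hus i j hij).left_ne_one

theorem lexGT_prod_of_perm {L L' : List (FreeMonoid α)} (hL : L.Pairwise LexGT)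
    (hperm : L'.Perm L) (hne : L' ≠ L) : LexGT L.prod L'.prod := by
  induction L generalizing L' with
  | nil => exact absurd hperm.eq_nil hne
  | cons a L ih =>
    cases L' with
    | nil => exact absurd hperm.symm.eq_nil (List.cons_ne_nil a L)
    | cons b L' =>
      rw [List.prod_cons, List.prod_cons]
      rcases eq_or_ne b a with rfl | hba
      · exact (ih hL.of_cons hperm.cons_inv fun h => hne (h ▸ rfl)).mul_left b
      · have hb : b ∈ L := List.mem_of_ne_of_mem hba (hperm.subset List.mem_cons_self)
        exact (List.rel_of_pairwise_cons hL hb).mul_right _ _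

theorem lexGT_prod_ofFn_comp_perm {d : ℕ} {w : Fin d → FreeMonoid α}
    (hw : (List.ofFn w).Pairwise LexGT) {σ : Equiv.Perm (Fin d)} (hσ : σ ≠ 1) :
    LexGT (List.ofFn w).prod (List.ofFn (w ∘ σ)).prod := by
  have hinj : Function.Injective w :=
    List.nodup_ofFn.1 (hw.imp fun h => h.lt.ne')
  refine lexGT_prod_of_perm hw (Equiv.Perm.ofFn_comp_perm σ w) fun h => hσ ?_
  exact DFunLike.coe_injective (hinj.comp_left (List.ofFn_injective h))

end Division

section Spanning

theorem lift_mem_of_ne_one {α M σ : Type*} [Monoid M] [SetLike σ M] [MulMemClass σ M] {S : σ}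
    {a : α → M} (ha : ∀ i, a i ∈ S) {W : FreeMonoid α} (hW : W ≠ 1) : FreeMonoid.lift a W ∈ S := by
  rw [FreeMonoid.lift_apply]
  refine list_prod_mem_of_ne_nil (mt List.map_eq_nil_iff.1 hW) fun x hx => ?_
  obtain ⟨i, -, rfl⟩ := List.mem_map.1 hx
  exact ha i

theorem lift_mem_of_length_eq {α M σ : Type*} [Monoid M] [SetLike σ M] [MulMemClass σ M] {S : σ}
    {a : α → M} (ha : ∀ i, a i ∈ S) {W W' : FreeMonoid α} (hlen : W'.length = W.length)
    (hW : FreeMonoid.lift a W ∈ S) : FreeMonoid.lift a W' ∈ S := by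
  by_cases hW' : W' = 1
  · rw [hW', FreeMonoid.length_one] at hlen
    rwa [hW', ← FreeMonoid.length_eq_zero.1 hlen.symm]
  · exact lift_mem_of_ne_one ha hW'

theorem lift_mul_mem {α M σ : Type*} [Monoid M] [SetLike σ M] [MulMemClass σ M] {S : σ}
    {a : α → M} (ha : ∀ i, a i ∈ S) (W : FreeMonoid α) {s : M} (hs : s ∈ S) :
    FreeMonoid.lift a W * s ∈ S := by
  by_cases hW : W = 1
  · rwa [hW, map_one, one_mul]
  · exact mul_mem (lift_mem_of_ne_one ha hW) hs

theorem image_powProducts_subset {M N : Type*} [Monoid M] [Monoid N] (φ : M →* N) (Y : Set M)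
    (h : ℕ) : φ '' powProducts Y h ⊆ powProducts (φ '' Y) h := by
  rintro _ ⟨_, ⟨L, hlen, hY, rfl⟩, rfl⟩
  refine ⟨L.map (Prod.map φ id), by rwa [List.length_map], ?_, ?_⟩
  · exact List.forall_mem_map.2 fun p hp => Set.mem_image_of_mem φ (hY p hp)
  · rw [map_list_prod, List.map_map, List.map_map]
    exact congrArg List.prod (List.map_congr_left fun p _ => map_pow φ p.1 p.2)

variable {K B α : Type*} [CommRing K] [Ring B] [Algebra K B] {S : NonUnitalSubalgebra K B}
  {V : Submodule K B} {f : NCPoly K} {a : α → B} {d : ℕ}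

theorem coeff_smul_mul_prod_mem (hf : ∀ x : ℕ → B, (∀ i, x i ∈ S) → f.eval x = 0)
    (hhigh : ∀ v : FreeMonoid ℕ, d < v.length → ∀ s ∈ S, f.coeff v • s ∈ V) (u : Fin d → ℕ)
    {y : Fin d → B} (hy : ∀ j, y j ∈ S) {b : B} (hb : ∀ s ∈ S, b * s ∈ S)
    (hperm : ∀ σ : Equiv.Perm (Fin d), σ ≠ 1 →
      f.coeff (FreeMonoid.ofList (List.ofFn (u ∘ σ))) • (b * (List.ofFn (y ∘ σ)).prod) ∈ V) :
    f.coeff (FreeMonoid.ofList (List.ofFn u)) • (b * (List.ofFn y).prod) ∈ V := by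
  have hlin := congrArg (b * ·) (sum_perm_add_sum_polarization hf u hy)
  simp only [mul_add, mul_sum, mul_smul_comm, mul_zero] at hlin
  rw [← add_sum_erase _ _ (mem_univ (1 : Equiv.Perm (Fin d))), add_assoc, Equiv.Perm.coe_one,
    Function.comp_id, Function.comp_id] at hlin
  rw [eq_neg_of_add_eq_zero_left hlin]
  refine V.neg_mem (V.add_mem (V.sum_mem fun σ hσ => hperm σ (ne_of_mem_erase hσ))
    (V.sum_mem fun v hv => ?_))
  have hv := (mem_filter.1 hv).2
  exact hhigh v hv _ (hb _ (polarization_mem u hy _ (Nat.ne_zero_of_lt hv)))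

theorem lift_mul_prod_ofFn {M : Type*} [Monoid M] (a : α → M) (v : FreeMonoid α)
    (w : Fin d → FreeMonoid α) :
    FreeMonoid.lift a (v * (List.ofFn w).prod) =
      FreeMonoid.lift a v * (List.ofFn (FreeMonoid.lift a ∘ w)).prod := by
  rw [map_mul, map_list_prod, List.map_ofFn]

theorem length_list_prod (L : List (FreeMonoid α)) :
    L.prod.length = (L.map FreeMonoid.length).sum := by
  rw [FreeMonoid.length, FreeMonoid.toList_prod, List.length_flatten, List.map_map]
  rfl

variable [LinearOrder α]

theorem coeff_smul_lift_mem [Finite α] (hf : ∀ x : ℕ → B, (∀ i, x i ∈ S) → f.eval x = 0)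
    (hhigh : ∀ v : FreeMonoid ℕ, d < v.length → ∀ s ∈ S, f.coeff v • s ∈ V) {k : ℕ}
    (ha : ∀ i, a i ∈ S) (hS : ∀ W : FreeMonoid α, W.length = k → FreeMonoid.lift a W ∈ S)
    (hV : ∀ W : FreeMonoid α, W.length = k → ¬ NDivisible d W → FreeMonoid.lift a W ∈ V)
    {W : FreeMonoid α} (hW : W.length = k) {u : FreeMonoid ℕ} (hu : u.length = d) :
    f.coeff u • FreeMonoid.lift a W ∈ V := by
  have hfin : {W : FreeMonoid α | W.length = k}.Finite := List.finite_length_eq α k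
  suffices ∀ u : FreeMonoid ℕ, u.length = d → f.coeff u • FreeMonoid.lift a W ∈ V from this u hu
  refine (hfin.wellFoundedOn (r := (· < ·))).induction (P := fun W => ∀ u : FreeMonoid ℕ,
    u.length = d → f.coeff u • FreeMonoid.lift a W ∈ V) hW fun W hW ih u hu => ?_
  by_cases hdiv : NDivisible d W
  · obtain ⟨v, w, hw, rfl, hne⟩ := hdiv.exists_ofFn
    obtain ⟨u, rfl⟩ : ∃ u' : Fin d → ℕ, FreeMonoid.ofList (List.ofFn u') = u :=
      hu ▸ ⟨u.toList.get, List.ofFn_get u.toList⟩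
    rw [lift_mul_prod_ofFn]
    refine coeff_smul_mul_prod_mem hf hhigh u (fun j => ?_) (fun s => lift_mul_mem ha v)
      fun σ hσ => ?_
    · rcases hne j with hj | hj
      · exact lift_mem_of_ne_one ha hj
      · exact hS _ (hj ▸ hW)
    · rw [Function.comp_assoc, ← lift_mul_prod_ofFn]
      refine ih _ ?_ ((lexGT_prod_ofFn_comp_perm hw hσ).mul_left v).lt _ List.length_ofFn
      rw [Set.mem_ofPred_eq, FreeMonoid.length_mul, length_list_prod,
        ((Equiv.Perm.ofFn_comp_perm σ w).map _).sum_eq, ← length_list_prod, ← FreeMonoid.length_mul]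
      exact hW
  · exact V.smul_mem _ (hV W hW hdiv)

theorem coeff_smul_mem_span_not_nDivisible [Finite α]
    (hf : ∀ x : ℕ → B, (∀ i, x i ∈ S) → f.eval x = 0) (ha : ∀ i, a i ∈ S)
    (hspan : S.toSubmodule ≤ Submodule.span K (Set.range (FreeMonoid.lift a) ∩ S)) {n : ℕ}
    (hdeg : f.degree ≤ n) (v : FreeMonoid ℕ) {s : B} (hs : s ∈ S) :
    f.coeff v • s ∈ Submodule.span K (FreeMonoid.lift a '' {W | ¬ NDivisible n W}) := by
  by_cases hv : f.coeff v = 0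
  · rw [hv, zero_smul]
    exact Submodule.zero_mem _
  have hvdeg : v.length ≤ f.degree := le_sup (f := FreeMonoid.length) (Finsupp.mem_support_iff.2 hv)
  suffices Submodule.span K (Set.range (FreeMonoid.lift a) ∩ S) ≤
      (Submodule.span K (FreeMonoid.lift a '' {W | ¬ NDivisible n W})).comap
        (LinearMap.lsmul K B (f.coeff v)) from this (hspan hs)
  rw [Submodule.span_le]
  rintro _ ⟨⟨W, rfl⟩, hW⟩
  exact coeff_smul_lift_mem hf
    (fun v' _ s hs => coeff_smul_mem_span_not_nDivisible hf ha hspan hdeg v' hs) ha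
    (fun W' hW' => lift_mem_of_length_eq ha hW' hW)
    (fun W' _ hdiv => Submodule.subset_span ⟨W', mt (.mono (hvdeg.trans hdeg)) hdiv, rfl⟩) rfl rfl
termination_by f.degree + 1 - v.length

theorem le_span_not_nDivisible [Finite α]
    (hf : ∀ x : ℕ → B, (∀ i, x i ∈ S) → f.eval x = 0) (ha : ∀ i, a i ∈ S)
    (hspan : S.toSubmodule ≤ Submodule.span K (Set.range (FreeMonoid.lift a) ∩ S))
    (hadm : f.Admissible) {n : ℕ} (hdeg : f.degree ≤ n) :
    S.toSubmodule ≤ Submodule.span K (FreeMonoid.lift a '' {W | ¬ NDivisible n W}) := by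
  obtain ⟨v, hv⟩ := hadm
  intro s hs
  simpa only [hv, one_smul] using coeff_smul_mem_span_not_nDivisible hf ha hspan hdeg v hs

theorem exists_isSpanHeight [Fintype α] (hf : ∀ x : ℕ → B, (∀ i, x i ∈ S) → f.eval x = 0)
    (ha : ∀ i, a i ∈ S)
    (hspan : S.toSubmodule ≤ Submodule.span K (Set.range (FreeMonoid.lift a) ∩ S))
    (hadm : f.Admissible) {n : ℕ} (hn : 2 ≤ n) (hdeg : f.degree ≤ n) :
    ∃ h : ℕ, IsSpanHeight K S.toSubmodule (FreeMonoid.lift a '' shortWords α n) h ∧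
      (h : ℝ) ≤ Phi n (Fintype.card α) := by
  obtain ⟨k, hk, hkΦ⟩ := exists_height_bound α hn
  have hle : S.toSubmodule ≤
      Submodule.span K (powProducts (FreeMonoid.lift a '' shortWords α n) k) :=
    (le_span_not_nDivisible hf ha hspan hadm hdeg).trans
      (Submodule.span_mono ((Set.image_mono hk).trans (image_powProducts_subset _ _ _)))
  obtain ⟨h, hh, hhk⟩ : ∃ h, IsSpanHeight K S.toSubmodule (FreeMonoid.lift a '' shortWords α n) h ∧
      h ≤ k := exists_isLeast_le hle
  exact ⟨h, hh, (Nat.cast_le.2 hhk).trans hkΦ⟩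

end Spanning

section Generation

variable {K α : Type*} [CommRing K]

theorem adjoin_range_le_span {B : Type*} [Ring B] [Algebra K B] (a : α → B) :
    (NonUnitalAlgebra.adjoin K (Set.range a)).toSubmodule ≤
      Submodule.span K (FreeMonoid.lift a '' {1}ᶜ) := by
  rw [NonUnitalAlgebra.adjoin_eq_span]
  refine Submodule.span_mono fun x hx => ?_
  induction hx using Subsemigroup.closure_induction with
  | mem x hx =>
    obtain ⟨i, rfl⟩ := hx
    exact ⟨FreeMonoid.of i, FreeMonoid.of_ne_one i, FreeMonoid.lift_eval_of a i⟩
  | mul x y _ _ hx hy =>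
    obtain ⟨W, hW, rfl⟩ := hx
    obtain ⟨W', -, rfl⟩ := hy
    exact ⟨W * W', fun h => hW (List.append_eq_nil_iff.1 h).1, map_mul _ W W'⟩

theorem prod_mem_span_of_length_le {B : Type*} [Ring B] [Algebra K B] {a : α → B} {L : List B}
    (hL : ∀ x ∈ L, x ∈ Submodule.span K (FreeMonoid.lift a '' {1}ᶜ)) :
    L.prod ∈ Submodule.span K (FreeMonoid.lift a '' {W | L.length ≤ W.length}) := by
  induction L with
  | nil => exact Submodule.subset_span ⟨1, Nat.zero_le _, map_one _⟩
  | cons x L ih =>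
    have hmul := Submodule.mul_mem_mul (hL x List.mem_cons_self)
      (ih fun y hy => hL y (List.mem_cons_of_mem x hy))
    rw [Submodule.span_mul_span] at hmul
    rw [List.prod_cons]
    refine Submodule.span_mono ?_ hmul
    rintro _ ⟨_, ⟨W, hW, rfl⟩, _, ⟨W', hW', rfl⟩, rfl⟩
    refine ⟨W * W', ?_, map_mul _ W W'⟩
    have hW : 0 < W.length := Nat.pos_of_ne_zero (mt FreeMonoid.length_eq_zero.1 hW)
    have hW' : L.length ≤ W'.length := hW'
    rw [Set.mem_ofPred_eq, FreeMonoid.length_mul, List.length_cons]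
    omega

theorem top_le_span_range_lift {A : Type*} [Ring A] [Algebra K A] {a : α → A}
    (ha : Algebra.adjoin K (Set.range a) = ⊤) :
    (⊤ : Submodule K A) ≤ Submodule.span K (Set.range (FreeMonoid.lift a)) := by
  rw [← Algebra.top_toSubmodule, ← ha, Algebra.adjoin_eq_span, ← FreeMonoid.mrange_lift,
    MonoidHom.coe_mrange]

theorem exists_isUnitalAlgHeight {A : Type*} [Ring A] [Algebra K A] {l n : ℕ} {a : Fin l → A}
    (ha : Algebra.adjoin K (Set.range a) = ⊤) {f : NCPoly K} (hf : IsUnitalIdentity A f)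
    (hadm : f.Admissible) (hn : 2 ≤ n) (hdeg : f.degree ≤ n) :
    ∃ h : ℕ, IsUnitalAlgHeight K a n h ∧ (h : ℝ) ≤ Phi n l := by
  have h := exists_isSpanHeight (S := (⊤ : NonUnitalSubalgebra K A)) (fun x _ => hf x)
    (fun _ => NonUnitalAlgebra.mem_top)
    (by simpa only [NonUnitalAlgebra.top_toSubmodule, NonUnitalAlgebra.coe_top, Set.inter_univ]
      using top_le_span_range_lift ha) hadm hn hdeg
  rwa [NonUnitalAlgebra.top_toSubmodule, Fintype.card_fin] at h

variable {A : Type*} [NonUnitalRing A] [Module K A] [IsScalarTower K A A] [SMulCommClass K A A]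
  {a : α → A}

theorem range_inr_eq_adjoin (ha : NonUnitalAlgebra.adjoin K (Set.range a) = ⊤) :
    NonUnitalAlgHom.range (Unitization.inrNonUnitalAlgHom K A) =
      NonUnitalAlgebra.adjoin K (Set.range fun i => (a i : Unitization K A)) := by
  rw [← NonUnitalAlgebra.map_top, ← ha, NonUnitalAlgHom.map_adjoin, ← Set.range_comp]
  rfl

theorem range_inr_le_span (ha : NonUnitalAlgebra.adjoin K (Set.range a) = ⊤) :
    (NonUnitalAlgHom.range (Unitization.inrNonUnitalAlgHom K A)).toSubmodule ≤
      Submodule.span K (FreeMonoid.lift (fun i => (a i : Unitization K A)) '' {1}ᶜ) :=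
  range_inr_eq_adjoin ha ▸ adjoin_range_le_span _

theorem exists_isAlgHeight {l n : ℕ} {a : Fin l → A}
    (ha : NonUnitalAlgebra.adjoin K (Set.range a) = ⊤) {f : NCPoly K} (hf : IsIdentity A f)
    (hadm : f.Admissible) (hn : 2 ≤ n) (hdeg : f.degree ≤ n) :
    ∃ h : ℕ, IsAlgHeight K a n h ∧ (h : ℝ) ≤ Phi n l := by
  have hgen (i : Fin l) : (a i : Unitization K A) ∈
      NonUnitalAlgHom.range (Unitization.inrNonUnitalAlgHom K A) := ⟨a i, rfl⟩
  have heval (x : ℕ → Unitization K A)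
      (hx : ∀ i, x i ∈ NonUnitalAlgHom.range (Unitization.inrNonUnitalAlgHom K A)) :
      f.eval x = 0 := by
    choose y hy using hx
    obtain rfl : (fun i => (y i : Unitization K A)) = x := funext hy
    exact hf y
  have h := exists_isSpanHeight heval hgen ((range_inr_le_span ha).trans (Submodule.span_mono ?_))
    hadm hn hdeg
  · rwa [Fintype.card_fin] at h
  · rintro _ ⟨W, hW, rfl⟩
    exact ⟨⟨W, rfl⟩, lift_mem_of_ne_one hgen hW⟩

end Generation

section Nil

section Algebra

variable {K B α : Type*} [CommRing K] {m k : ℕ}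

theorem length_pow (W : FreeMonoid α) (k : ℕ) : (W ^ k).length = k * W.length := by
  rw [← List.prod_replicate, length_list_prod, List.map_replicate, List.sum_replicate, smul_eq_mul]

theorem map_eq_zero_of_mem_powProducts [MonoidWithZero B] {φ : FreeMonoid α →* B}
    (hnil : ∀ W, W ≠ 1 → φ W ^ m = 0) {W : FreeMonoid α}
    (hW : W ∈ powProducts (shortWords α m) k) (hlen : k * m ^ 2 < W.length) : φ W = 0 := by
  contrapose! hlen
  obtain ⟨L, hLk, hL, rfl⟩ := hW
  have hpow : ∀ p ∈ L, (p.1 ^ p.2).length ≤ m ^ 2 := fun p hp => by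
    rcases eq_or_ne p.1 1 with h1 | h1
    · simp [h1]
    · have hne : φ (p.1 ^ p.2) ≠ 0 := fun h0 => hlen <| by
        rw [map_list_prod]
        exact List.prod_eq_zero (h0 ▸ List.mem_map_of_mem (List.mem_map_of_mem hp))
      have hpm : p.2 < m := not_le.1 fun h => hne <| by
        rw [map_pow]
        exact pow_eq_zero_of_le h (hnil p.1 h1)
      rw [length_pow, sq]
      exact Nat.mul_le_mul hpm.le (hL p hp).le
  rw [length_list_prod]
  refine (List.sum_le_card_nsmul _ (m ^ 2) ?_).trans ?_
  · exact List.forall_mem_map.2 (List.forall_mem_map.2 hpow)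
  · rw [List.length_map, List.length_map, smul_eq_mul]
    exact Nat.mul_le_mul_right _ hLk

variable (K m) in
/-- The noncommutative polynomial `x₀ ^ m`, which turns `x ^ m = 0` into a polynomial identity. -/
noncomputable def powPoly : NCPoly K :=
  MonoidAlgebra.single (FreeMonoid.of 0 ^ m) 1

variable [Ring B] [Algebra K B]

theorem powPoly_eval (m : ℕ) (x : ℕ → B) : (powPoly K m).eval x = x 0 ^ m := by
  rw [NCPoly.eval, powPoly, MonoidAlgebra.lift_single, one_smul, map_pow, FreeMonoid.lift_eval_of]

theorem powPoly_coeff_eq_zero {v : FreeMonoid ℕ} (hv : m < v.length) :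
    (powPoly K m).coeff v = 0 := by
  rw [powPoly, MonoidAlgebra.coeff_single]
  refine Finsupp.single_eq_of_ne ?_
  rintro rfl
  rw [length_pow, FreeMonoid.length_of, mul_one] at hv
  exact hv.false

variable {S : NonUnitalSubalgebra K B} {a : α → B} [LinearOrder α] [Finite α]

theorem lift_eq_zero_of_nil (hnil : ∀ x ∈ S, x ^ m = 0) (ha : ∀ i, a i ∈ S)
    (hk : {W : FreeMonoid α | ¬ NDivisible m W} ⊆ powProducts (shortWords α m) k)
    {W : FreeMonoid α} (hW : k * m ^ 2 < W.length) : FreeMonoid.lift a W = 0 := by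
  have hne (W' : FreeMonoid α) (hW' : W'.length = W.length) : W' ≠ 1 := by
    rintro rfl
    exact (hW' ▸ hW).not_ge (Nat.zero_le _)
  have h : (powPoly K m).coeff (FreeMonoid.of 0 ^ m) • FreeMonoid.lift a W ∈ (⊥ : Submodule K B) :=
    coeff_smul_lift_mem (S := S) (fun x hx => by rw [powPoly_eval, hnil _ (hx 0)])
      (fun v hv s _ => by rw [powPoly_coeff_eq_zero hv, zero_smul]; exact Submodule.zero_mem _) ha
      (fun W' hW' => lift_mem_of_ne_one ha (hne W' hW'))
      (fun W' hW' hdiv => map_eq_zero_of_mem_powProducts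
        (fun W hW => hnil _ (lift_mem_of_ne_one ha hW)) (hk hdiv) (hW' ▸ hW))
      rfl (by rw [length_pow, FreeMonoid.length_of, mul_one])
  rwa [powPoly, MonoidAlgebra.coeff_single, Finsupp.single_eq_same, one_smul] at h

theorem prod_eq_zero_of_nil (hnil : ∀ x ∈ S, x ^ m = 0) (ha : ∀ i, a i ∈ S)
    (hspan : S.toSubmodule ≤ Submodule.span K (FreeMonoid.lift a '' {1}ᶜ))
    (hk : {W : FreeMonoid α | ¬ NDivisible m W} ⊆ powProducts (shortWords α m) k)
    {L : List B} (hL : ∀ x ∈ L, x ∈ S) (hlen : k * m ^ 2 < L.length) : L.prod = 0 := by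
  have hzero : Submodule.span K (FreeMonoid.lift a '' {W | L.length ≤ W.length}) ≤ ⊥ := by
    rw [Submodule.span_le]
    rintro _ ⟨W, hW, rfl⟩
    exact lift_eq_zero_of_nil hnil ha hk (hlen.trans_le hW)
  exact hzero (prod_mem_span_of_length_le fun x hx => hspan (hL x hx))

end Algebra

theorem exists_isNilpotencyClass_le {R α : Type*} [NonUnitalRing R] [LinearOrder α] [Finite α]
    {a : α → R} (ha : NonUnitalAlgebra.adjoin ℤ (Set.range a) = ⊤) {m k : ℕ}
    (hnil : ∀ x : R, (x : Unitization ℤ R) ^ m = 0)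
    (hk : {W : FreeMonoid α | ¬ NDivisible m W} ⊆ powProducts (shortWords α m) k) :
    ∃ N, IsNilpotencyClass R N ∧ N ≤ k * m ^ 2 + 1 := by
  have hmem (x : R) : (x : Unitization ℤ R) ∈
      NonUnitalAlgHom.range (Unitization.inrNonUnitalAlgHom ℤ R) := ⟨x, rfl⟩
  refine exists_isLeast_le (k := k * m ^ 2 + 1) fun x => ?_
  refine prod_eq_zero_of_nil (K := ℤ) (B := Unitization ℤ R) (Set.forall_mem_range.2 hnil)
    (fun i => hmem (a i)) (range_inr_le_span ha) hk ?_ ?_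
  · exact List.forall_mem_ofFn_iff.2 fun i => hmem (x i)
  · rw [List.length_ofFn]
    exact Nat.lt_succ_self _

/-- The projection of the free ring onto the free ring with the identity `x ^ m = 0`. -/
noncomputable def nilProj (l m : ℕ) : FreeNURing l →ₙₐ[ℤ] FreeNilRing l m where
  toFun x := (x : (nilCon l m).Quotient)
  map_smul' _ _ := rfl
  map_mul' _ _ := rfl
  map_zero' := rfl
  map_add' _ _ := rfl

theorem nilProj_surjective (l m : ℕ) : Function.Surjective (nilProj l m) :=
  Quotient.mk''_surjective

theorem exists_inr_eq_pow {R R' F : Type*} [NonUnitalRing R] [NonUnitalRing R'] [FunLike F R R']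
    [MulHomClass F R R'] (π : F) {j : ℕ} (hj : 1 ≤ j) (x : R) : ∃ y : R,
      (y : Unitization ℤ R) = (x : Unitization ℤ R) ^ j ∧
      (π y : Unitization ℤ R') = (π x : Unitization ℤ R') ^ j := by
  induction j, hj using Nat.le_induction with
  | base => exact ⟨x, (pow_one _).symm, (pow_one _).symm⟩
  | succ j _ ih =>
    obtain ⟨y, hy, hπy⟩ := ih
    refine ⟨y * x, ?_, ?_⟩
    · rw [Unitization.inr_mul, hy, pow_succ]
    · rw [map_mul, Unitization.inr_mul, hπy, pow_succ]

theorem inr_pow_eq_zero (l : ℕ) {m : ℕ} (hm : 1 ≤ m) (x : FreeNilRing l m) :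
    (x : Unitization ℤ (FreeNilRing l m)) ^ m = 0 := by
  obtain ⟨x, rfl⟩ := nilProj_surjective l m x
  obtain ⟨y, hy, hπy⟩ := exists_inr_eq_pow (nilProj l m) hm x
  have hy0 : nilProj l m y = 0 := (RingCon.eq _).2 (RingConGen.Rel.of _ _ ⟨rfl, x, hy⟩)
  rw [← hπy, hy0, Unitization.inr_zero]

theorem adjoin_range_single_of_eq_top {K α : Type*} [CommRing K] :
    NonUnitalAlgebra.adjoin K (Set.range fun i : α =>
      (MonoidAlgebra.single (FreeSemigroup.of i) 1 : MonoidAlgebra K (FreeSemigroup α))) = ⊤ := by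
  rw [NonUnitalAlgebra.eq_top_iff]
  intro x
  induction x using MonoidAlgebra.induction_linear with
  | zero => exact zero_mem _
  | add x y hx hy => exact add_mem hx hy
  | single w r =>
    rw [← mul_one r, ← smul_eq_mul, ← MonoidAlgebra.smul_single]
    refine SMulMemClass.smul_mem r ?_
    induction w using FreeSemigroup.recOnMul with
    | ih1 i => exact NonUnitalAlgebra.subset_adjoin K ⟨i, rfl⟩
    | ih2 i w hi hw =>
      have hsingle : (MonoidAlgebra.single (FreeSemigroup.of i * w) 1 :
          MonoidAlgebra K (FreeSemigroup α)) =
          MonoidAlgebra.single (FreeSemigroup.of i) 1 * MonoidAlgebra.single w 1 := by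
        rw [MonoidAlgebra.single_mul_single, one_mul]
      rw [hsingle]
      exact mul_mem hi hw

theorem adjoin_range_nilProj_eq_top (l m : ℕ) :
    NonUnitalAlgebra.adjoin ℤ (Set.range (nilProj l m ∘ fun i =>
      MonoidAlgebra.single (FreeSemigroup.of i) 1)) = ⊤ := by
  rw [Set.range_comp, ← NonUnitalAlgHom.map_adjoin, adjoin_range_single_of_eq_top,
    NonUnitalAlgebra.map_top, NonUnitalAlgebra.range_eq_top]
  exact nilProj_surjective l m

open Asymptotics Filter in
theorem exists_nilpotencyClass_isLittleO (l : ℕ) : ∃ N : ℕ → ℕ,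
    (∀ m : ℕ, 1 ≤ m → IsNilpotencyClass (FreeNilRing l m) (N m)) ∧
    ∀ c : ℝ, 1 < c → (fun m : ℕ => (N m : ℝ)) =o[atTop] fun m : ℕ => c ^ m := by
  have hex (m : ℕ) (hm : 1 ≤ m) : ∃ N : ℕ, IsNilpotencyClass (FreeNilRing l m) N ∧
      (2 ≤ m → (N : ℝ) ≤ m ^ 2 * Phi m l + 1) := by
    have hclass {k : ℕ} := exists_isNilpotencyClass_le (k := k)
      (adjoin_range_nilProj_eq_top l m) (inr_pow_eq_zero l hm)
    rcases hm.eq_or_lt with rfl | hm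
    · obtain ⟨N, hN, -⟩ := hclass (k := 0) fun W hW =>
        absurd ⟨1, [W], rfl, List.pairwise_singleton _ _, by simp⟩ hW
      exact ⟨N, hN, fun h => absurd h (by norm_num)⟩
    · obtain ⟨k, hk, hkΦ⟩ := exists_height_bound (Fin l) hm
      obtain ⟨N, hN, hNk⟩ := hclass hk
      refine ⟨N, hN, fun _ => ?_⟩
      rw [Fintype.card_fin] at hkΦ
      calc (N : ℝ) ≤ k * m ^ 2 + 1 := by exact_mod_cast hNk
        _ ≤ Phi m l * m ^ 2 + 1 := by gcongr
        _ = m ^ 2 * Phi m l + 1 := by rw [mul_comm]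
  choose! N hN hbound using hex
  refine ⟨N, hN, fun c hc => ?_⟩
  have hone : (fun _ : ℕ => (1 : ℝ)) =o[atTop] fun m : ℕ => c ^ m :=
    isLittleO_const_left.2 <| .inr <|
      tendsto_norm_atTop_atTop.comp (tendsto_pow_atTop_atTop_of_one_lt hc)
  refine (IsBigO.of_bound 1 ?_).trans_isLittleO ((pow_mul_Phi_isLittleO 2 l hc).add hone)
  filter_upwards [eventually_ge_atTop 2] with m hm
  rw [Real.norm_of_nonneg (by positivity), one_mul]
  exact (hbound m (by omega) hm).trans (le_abs_self _)

end Nil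

end Shirshov

theorem mainTheorem1 :
    -- height of the set of words that are not `n`-divisible
    (∀ n l : ℕ, 2 ≤ n → ∃ h : ℕ,
      Shirshov.IsSetHeight {W : FreeMonoid (Fin l) | ¬ Shirshov.NDivisible n W}
        (Shirshov.shortWords (Fin l) n) h ∧ (h : ℝ) ≤ Shirshov.Phi n l) ∧
    -- for fixed `l`, `Φ(n, l) = n ^ (12 (1 + o(1)) log₃ n)` as `n → ∞`
    (∀ l : ℕ, 1 ≤ l → ∃ ε : ℕ → ℝ, Filter.Tendsto ε Filter.atTop (nhds 0) ∧
      ∀ n : ℕ, 2 ≤ n → Shirshov.Phi n l = (n : ℝ) ^ (12 * (1 + ε n) * Real.logb 3 n)) ∧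
    -- in particular `Φ` is subexponential in `n`
    (∀ (l : ℕ) (c : ℝ), 1 < c →
      Asymptotics.IsLittleO Filter.atTop (fun n : ℕ => Shirshov.Phi n l) (fun n : ℕ => c ^ n)) ∧
    -- for fixed `n`, `Φ` is linearly bounded in `l`
    (∀ n : ℕ, 2 ≤ n → ∃ C : ℝ, ∀ l : ℕ, 1 ≤ l → Shirshov.Phi n l < C * l) ∧
    -- height of `l`-generated PI-algebras, not assumed unital
    (∀ (K : Type*) (A : Type*) [CommRing K] [NonUnitalRing A] [Module K A]
      [IsScalarTower K A A] [SMulCommClass K A A] (n l : ℕ) (a : Fin l → A)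
      (f : Shirshov.NCPoly K), 2 ≤ n → NonUnitalAlgebra.adjoin K (Set.range a) = ⊤ →
      f.Admissible → f.degree = n → Shirshov.IsIdentity A f →
      ∃ h : ℕ, Shirshov.IsAlgHeight K a n h ∧ (h : ℝ) ≤ Shirshov.Phi n l) ∧
    -- height of `l`-generated unital PI-algebras
    (∀ (K : Type*) (A : Type*) [CommRing K] [Ring A] [Algebra K A] (n l : ℕ) (a : Fin l → A)
      (f : Shirshov.NCPoly K), 2 ≤ n → Algebra.adjoin K (Set.range a) = ⊤ →
      f.Admissible → f.degree = n → Shirshov.IsUnitalIdentity A f →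
      ∃ h : ℕ, Shirshov.IsUnitalAlgHeight K a n h ∧ (h : ℝ) ≤ Shirshov.Phi n l) ∧
    -- the nilpotency class of the free `l`-generated ring with `x ^ m = 0` is subexponential in `m`
    (∀ l : ℕ, ∃ N : ℕ → ℕ,
      (∀ m : ℕ, 1 ≤ m → Shirshov.IsNilpotencyClass (Shirshov.FreeNilRing l m) (N m)) ∧
      ∀ c : ℝ, 1 < c → Asymptotics.IsLittleO Filter.atTop (fun m : ℕ => (N m : ℝ))
        (fun m : ℕ => c ^ m)) := by
  refine ⟨fun n l hn => ?_, fun l hl => Shirshov.exists_Phi_eq_rpow hl, fun l c hc => ?_,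
    fun n hn => ⟨Shirshov.Phi n 1 + 1, fun l hl => ?_⟩, ?_, ?_,
    Shirshov.exists_nilpotencyClass_isLittleO⟩
  · simpa only [Fintype.card_fin] using Shirshov.exists_isSetHeight (Fin l) hn
  · simpa only [pow_zero, one_mul] using Shirshov.pow_mul_Phi_isLittleO 0 l hc
  · rw [Shirshov.Phi_eq_mul, mul_comm]
    gcongr
    exact lt_add_one _
  · intro K A _ _ _ _ _ n l a f hn ha hadm hdeg hf
    exact Shirshov.exists_isAlgHeight ha hf hadm hn hdeg.le
  · intro K A _ _ _ n l a f hn ha hadm hdeg hf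
    exact Shirshov.exists_isUnitalAlgHeight ha hf hadm hn hdeg.le
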